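/- Smoothness of maps between (Hausdorff) locally convex spaces is understood in the sense of Michal–Bastiani: $f\colon U\to F$, $U\subseteq E$ open, is smooth if it is continuous, all iterated directional derivatives $D^jf(x)(h_1,\dots,h_j)=(\partial_{h_j}\cdots\partial_{h_1}f)(x)$ exist, and all maps $D^jf\colon U\times E^j\to F$ are continuous; locally convex manifolds and Lie groups are defined accordingly. A Lie group $G$ with Lie algebra $\mathfrak g=T_{\mathbf 1}G$ is *regular* if for every smooth $\xi\colon[0,1]\to\mathfrak g$ the equation $\gamma'(t)\cdot\gamma(t)^{-1}=\xi(t)$, $\gamma(0)=\mathbf 1$, has a solution $\gamma\colon[0,1]\to G$, and $\gamma(1)$ depends smoothly on $\xi\in C^\infty([0,1],\mathfrak g)$. Let $G$ be a regular Lie group modelled on a Fréchet space, and let $\rho\colon G\to \mathrm U(\mathcal H)$ be a smooth unitary representation on a complex Hilbert space $\mathcal H$, i.e. a group homomorphism for which the space $\mathcal H^\infty$ of smooth vectors (those $\psi\in\mathcal H$ for which $g\mapsto\rho(g)\psi$ is smooth) is dense in $\mathcal H$. Let $\mathrm d\rho\colon\mathfrak g\to\mathrm{End}(\mathcal H^\infty)$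 be the derived representation, $\mathrm d\rho(\xi)\psi=\frac{d}{dt}\big|_{t=0}\rho(\gamma_t)\psi$ for any curve $\gamma$ in $G$ with $\gamma_0=\mathbf 1$ and $\gamma'(0)=\xi$; it exists. Then $\mathcal H^\infty$ is complete (every Cauchy net converges) 1. for the weak topology, i.e. the locally convex topology generated by the seminorms $$p_{\boldsymbol\xi}(\psi)=\|\mathrm d\rho(\xi_n)\cdots\mathrm d\rho(\xi_1)\psi\|,\qquad \boldsymbol\xi=(\xi_n,\dots,\xi_1)\in\mathfrak g^n,\ n\in\mathbb N_0$$ (for $n=0$ the seminorm is the norm $\|\psi\|$), and 2. for the strong topology, i.e. the locally convex topology generated by the seminorms $$p_B(\psi)=\sup_{\boldsymbol\xi\in B}\|\mathrm d\rho(\xi_n)\cdots\mathrm d\rho(\xi_1)\psi\|,\qquad B\subseteq\mathfrak g^n \text{ bounded},\ n\in\mathbb N_0,$$ where these suprema are finite. -/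

import Mathlib

open Set Filter Topology
open scoped unitInterval Uniformity

namespace LCLie

section Calculus

variable {E F : Type*} [AddCommGroup E] [Module ℝ E] [TopologicalSpace E]
  [AddCommGroup F] [Module ℝ F] [TopologicalSpace F]

/-- `f'` is the derivative of `f` at `x` in the direction `h`, that is, the limit of
`(f (x + t h) - f x) / t` for `t → 0`, `t ≠ 0`. -/
def HasDirDerivAt (f : E → F) (f' : F) (x h : E) : Prop :=
  Tendsto (fun t : ℝ => t⁻¹ • (f (x + t • h) - f x)) (𝓝[≠] 0) (𝓝 f')

/-- Smoothness (in the sense of Michal and Bastiani) of a map `f` on an open subset `U` of a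
locally convex space, with values in a locally convex space: there are maps `D j`, where
`D j x (h₁, …, h_j)` is the iterated directional derivative `∂_{h_j} ⋯ ∂_{h₁} f (x)`,
and each `D j` is (jointly) continuous on `U × E ^ j`. As the limits are unique in the Hausdorff
space `F`, the maps `D j` are determined by `f` on `U`. -/
def SmoothOn (f : E → F) (U : Set E) : Prop :=
  ∃ D : (j : ℕ) → E → (Fin j → E) → F,
    (∀ x ∈ U, ∀ h : Fin 0 → E, D 0 x h = f x) ∧
    (∀ (j : ℕ), ∀ x ∈ U, ∀ (h : Fin j → E) (v : E),
      HasDirDerivAt (fun y => D j y h) (D (j + 1) x (Fin.snoc h v)) x v) ∧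
    (∀ j : ℕ, ContinuousOn (fun p : E × (Fin j → E) => D j p.1 p.2) (U ×ˢ univ))

end Calculus

section Manifolds

variable (E F : Type*) [AddCommGroup E] [Module ℝ E] [TopologicalSpace E]
  [AddCommGroup F] [Module ℝ F] [TopologicalSpace F]

/-- Smooth maps between manifolds `M`, `N` modelled on locally convex spaces `E`, `F`:
continuous maps which are smooth in charts. (A locally convex space is a manifold with the
identity as its only chart.) -/
def SmoothMap {M N : Type*} [TopologicalSpace M] [ChartedSpace E M] [TopologicalSpace N]
    [ChartedSpace F N] (f : M → N) : Prop :=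
  Continuous f ∧
    ∀ e ∈ atlas E M, ∀ e' ∈ atlas F N,
      SmoothOn (fun x => e' (f (e.symm x))) (e.target ∩ {x | f (e.symm x) ∈ e'.source})

/-- `G` is a locally convex Lie group modelled on `E`: all transition maps between charts of `G`
are smooth, and the multiplication and the inversion are smooth maps (the multiplication
`G × G → G` is expressed in the product charts of `G × G`). -/
structure IsLieGroup (G : Type*) [Group G] [TopologicalSpace G] [ChartedSpace E G] : Prop where
  smooth_transition : ∀ e ∈ atlas E G, ∀ e' ∈ atlas E G,
    SmoothOn (fun x => e' (e.symm x)) (e.target ∩ {x | e.symm x ∈ e'.source})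
  continuous_mul : Continuous fun p : G × G => p.1 * p.2
  smooth_mul : ∀ e₁ ∈ atlas E G, ∀ e₂ ∈ atlas E G, ∀ e ∈ atlas E G,
    SmoothOn (fun p : E × E => e (e₁.symm p.1 * e₂.symm p.2))
      ((e₁.target ×ˢ e₂.target) ∩ {p | e₁.symm p.1 * e₂.symm p.2 ∈ e.source})
  smooth_inv : SmoothMap E E fun g : G => g⁻¹

end Manifolds

section Regular

/-- The locally convex space `C^∞([0,1], E)`. A smooth path `ξ` is represented by the sequence
`(ξ, ξ', ξ'', …)` of its derivatives (one-sided at the end points), which are continuous maps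
`[0,1] → E`, and the topology is that of uniform convergence of all derivatives. -/
def SmoothPath (E : Type*) [AddCommGroup E] [Module ℝ E] [TopologicalSpace E]
    [IsTopologicalAddGroup E] [ContinuousSMul ℝ E] : Submodule ℝ (ℕ → C(I, E)) where
  carrier := {ξ | ∀ (k : ℕ) (t : I),
    Tendsto (fun s : I => ((s : ℝ) - (t : ℝ))⁻¹ • (ξ k s - ξ k t)) (𝓝[≠] t) (𝓝 (ξ (k + 1) t))}
  add_mem' := by
    intro a b ha hb k t
    refine ((ha k t).add (hb k t)).congr fun s => ?_
    simp only [Pi.add_apply, ContinuousMap.add_apply, ← smul_add]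
    rw [add_sub_add_comm]
  zero_mem' := by
    intro k t
    simpa using tendsto_const_nhds
  smul_mem' := by
    intro c a ha k t
    refine ((ha k t).const_smul c).congr fun s => ?_
    simp only [Pi.smul_apply, ContinuousMap.smul_apply, ← smul_sub]
    rw [smul_comm]

variable (E : Type*) [AddCommGroup E] [Module ℝ E] [TopologicalSpace E]
variable {G : Type*} [Group G] [TopologicalSpace G] [ChartedSpace E G]

/- The Lie algebra `T_1 G` of `G` is identified, as a locally convex space, with the model space
`E` by means of the preferred chart `chartAt E (1 : G)` at the identity. -/

/-- The curve `γ : [0,1] → G` solves the initial value problem `δᴿ γ = ξ`, `γ(0) = 1`, where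
`δᴿ γ (t) = γ'(t) · γ(t)⁻¹ ∈ T_1 G` is the right logarithmic derivative. As `γ'(t) · γ(t)⁻¹` is the
tangent vector at `s = t` of the curve `s ↦ γ(s) γ(t)⁻¹`, which passes through `1`, it is computed
in the chart at `1`. -/
def IsEvolution (ξ : I → E) (γ : I → G) : Prop :=
  Continuous γ ∧ γ 0 = 1 ∧
    ∀ t : I, Tendsto
      (fun s : I => ((s : ℝ) - (t : ℝ))⁻¹ •
        (chartAt E (1 : G) (γ s * (γ t)⁻¹) - chartAt E (1 : G) (1 : G)))
      (𝓝[≠] t) (𝓝 (ξ t))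

/-- Regularity of a Lie group (in the sense of Milnor): for every smooth `ξ : [0,1] → T_1 G` the
initial value problem `δᴿ γ = ξ`, `γ(0) = 1` has a solution `γ : [0,1] → G`, and `γ(1)` depends
smoothly on `ξ ∈ C^∞([0,1], T_1 G)`. -/
def IsRegular (G : Type*) [Group G] [TopologicalSpace G] [ChartedSpace E G]
    [IsTopologicalAddGroup E] [ContinuousSMul ℝ E] : Prop :=
  ∃ evol : SmoothPath E → G,
    (∀ ξ : SmoothPath E, ∃ γ : I → G, IsEvolution E (fun t => ξ.1 0 t) γ ∧ γ 1 = evol ξ) ∧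
    SmoothMap (SmoothPath E) E evol

end Regular

section Topologies

/- The weak and the strong topology on a complex (pre-)Hilbert space `V` on which a locally convex
space `𝔤` (a Lie algebra) acts by operators `π ξ`. -/

variable {𝔤 V : Type*} [AddCommGroup 𝔤] [Module ℝ 𝔤] [TopologicalSpace 𝔤]
  [NormedAddCommGroup V] [NormedSpace ℂ V] (π : 𝔤 → Module.End ℂ V)

/-- The operator `π_n(ξ) = π(ξ_n) ⋯ π(ξ_1)` of the `n`-tuple `ξ = (ξ_n, …, ξ_1)`. -/
def iter {n : ℕ} (ξ : Fin n → 𝔤) : Module.End ℂ V :=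
  (List.ofFn fun i => π (ξ i)).prod

/-- The seminorm `p_ξ(ψ) = ‖π(ξ_n) ⋯ π(ξ_1) ψ‖`; for `n = 0` it is the norm. -/
noncomputable def weakSeminorm {n : ℕ} (ξ : Fin n → 𝔤) : Seminorm ℂ V :=
  (normSeminorm ℂ V).comp (iter π ξ)

/-- The seminorm `p_B(ψ) = sup_{ξ ∈ B} ‖π(ξ_n) ⋯ π(ξ_1) ψ‖`, where `B ⊆ 𝔤 ^ n`. (The supremum of
seminorms is the pointwise one as soon as it is finite at every `ψ`.) -/
noncomputable def strongSeminorm {n : ℕ} (B : Set (Fin n → 𝔤)) : Seminorm ℂ V :=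
  ⨆ ξ : B, weakSeminorm π ξ.1

/-- The uniform structure of the locally convex topology generated by a family of seminorms. -/
abbrev seminormUniformSpace {ι : Type*} (p : ι → Seminorm ℂ V) : UniformSpace V :=
  ⨅ i, (p i).toAddGroupSeminorm.toSeminormedAddCommGroup.toUniformSpace

/-- The uniform structure of the weak topology, generated by all seminorms `p_ξ`,
`ξ ∈ 𝔤 ^ n`, `n ∈ ℕ`. -/
noncomputable abbrev weakUniformSpace : UniformSpace V :=
  seminormUniformSpace fun i : (Σ n : ℕ, (Fin n → 𝔤)) => weakSeminorm π i.2

/-- The uniform structure of the strong topology, generated by all seminorms `p_B`, where `B` is a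
bounded subset of `𝔤 ^ n`, `n ∈ ℕ`. -/
noncomputable abbrev strongUniformSpace : UniformSpace V :=
  seminormUniformSpace
    fun i : (Σ n : ℕ, {B : Set (Fin n → 𝔤) // Bornology.IsVonNBounded ℝ B}) =>
      strongSeminorm π i.2.1

/-- The suprema that define the seminorms `p_B` of the strong topology are finite. -/
def StrongSeminormsFinite : Prop :=
  ∀ (n : ℕ) (B : Set (Fin n → 𝔤)), Bornology.IsVonNBounded ℝ B →
    ∀ ψ : V, BddAbove ((fun ξ : Fin n → 𝔤 => ‖iter π ξ ψ‖) '' B)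

end Topologies

section Representations

variable (E : Type*) [AddCommGroup E] [Module ℝ E] [TopologicalSpace E]
  {G : Type*} [Group G] [TopologicalSpace G] [ChartedSpace E G]
  {H : Type*} [NormedAddCommGroup H] [InnerProductSpace ℂ H]

theorem SmoothOn.add {f g : E → H} {U : Set E} (hf : SmoothOn f U) (hg : SmoothOn g U) :
    SmoothOn (fun x => f x + g x) U := by
  obtain ⟨D, h0, h1, h2⟩ := hf
  obtain ⟨D', h0', h1', h2'⟩ := hg
  refine ⟨fun j x h => D j x h + D' j x h, ?_, ?_, fun j => (h2 j).add (h2' j)⟩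
  · intro x hx h
    simp only [h0 x hx h, h0' x hx h]
  · intro j x hx h v
    refine ((h1 j x hx h v).add (h1' j x hx h v)).congr fun t => ?_
    rw [← smul_add, add_sub_add_comm]

theorem SmoothOn.const_smul {f : E → H} {U : Set E} (c : ℂ) (hf : SmoothOn f U) :
    SmoothOn (fun x => c • f x) U := by
  obtain ⟨D, h0, h1, h2⟩ := hf
  refine ⟨fun j x h => c • D j x h, ?_, ?_, fun j => (h2 j).const_smul c⟩
  · intro x hx h
    simp only [h0 x hx h]
  · intro j x hx h v
    refine (Tendsto.const_smul (h1 j x hx h v) c).congr fun t => ?_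
    rw [← smul_sub, smul_comm]

theorem smoothOn_zero (U : Set E) : SmoothOn (fun _ : E => (0 : H)) U := by
  refine ⟨fun _ _ _ => 0, fun _ _ _ => rfl, fun j x _ h v => ?_, fun j => continuousOn_const⟩
  simp [HasDirDerivAt]

variable [CompleteSpace H]

/-- The space `H^∞` of smooth vectors of a unitary representation `ρ : G → U(H)`: the vectors `ψ`
whose orbit map `G → H`, `g ↦ ρ(g) ψ`, is smooth. -/
def smoothVectors (ρ : G →* unitary (H →L[ℂ] H)) : Submodule ℂ H where
  carrier := {ψ | SmoothMap E H fun g : G => (ρ g : H →L[ℂ] H) ψ}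
  add_mem' := by
    intro a b ha hb
    refine ⟨by simpa only [map_add] using Continuous.fun_add ha.1 hb.1, fun e he e' he' => ?_⟩
    obtain rfl : e' = OpenPartialHomeomorph.refl H := by simpa using he'
    simpa using (ha.2 e he _ he').add E (hb.2 e he _ he')
  zero_mem' := by
    refine ⟨by simpa using continuous_const, fun e he e' he' => ?_⟩
    obtain rfl : e' = OpenPartialHomeomorph.refl H := by simpa using he'
    simpa using smoothOn_zero E _
  smul_mem' := by
    intro c a ha
    refine ⟨by simpa only [map_smul] using Continuous.fun_const_smul ha.1 c, fun e he e' he' => ?_⟩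
    obtain rfl : e' = OpenPartialHomeomorph.refl H := by simpa using he'
    simpa using (ha.2 e he _ he').const_smul E c

/-- A unitary representation is smooth if its smooth vectors are dense. -/
def IsSmoothRep (ρ : G →* unitary (H →L[ℂ] H)) : Prop :=
  Dense (smoothVectors E ρ : Set H)

/-- The curve `γ` in `G` passes at time `0` through `1`, with velocity `ξ ∈ T_1 G`. -/
def HasVelocityAtOne (γ : ℝ → G) (ξ : E) : Prop :=
  ContinuousAt γ 0 ∧ γ 0 = 1 ∧
    Tendsto (fun t : ℝ => t⁻¹ • (chartAt E (1 : G) (γ t) - chartAt E (1 : G) (1 : G)))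
      (𝓝[≠] 0) (𝓝 ξ)

/-- `π = dρ` is the derived representation of `T_1 G` on `H^∞`:
`dρ(ξ) ψ = d/dt|_{t=0} ρ(γ_t) ψ` for every curve `γ` through `1` with velocity `ξ`. (Such a curve
exists for every `ξ`, so there is at most one such `π`.) -/
def IsDerivedRep (ρ : G →* unitary (H →L[ℂ] H)) (π : E → Module.End ℂ (smoothVectors E ρ)) :
    Prop :=
  ∀ (ξ : E) (ψ : smoothVectors E ρ) (γ : ℝ → G), HasVelocityAtOne E γ ξ →
    HasDerivAt (fun t : ℝ => (ρ (γ t) : H →L[ℂ] H) (ψ : H)) (π ξ ψ : H) 0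

end Representations

end LCLie

/-! Write π for the derived representation. It exists because a smooth orbit map, read in the chart
at 1, has a derivative along every curve with a velocity at 1. Unitarity makes each π(η)
skew-symmetric on the smooth vectors (`inner_derivedRep_left`).

Along a weakly Cauchy filter every vector π(ξ₁)⋯π(ξₙ)φ converges in the Hilbert space, and the
limits form multilinear maps Ψₙ. The candidate limit is the vector Ψ₀; it must be shown to be smooth
with jet (Ψₙ). Skew-symmetry passes to the limit as ⟨π(η)φ, Ψₙ(ξ)⟩ = -⟨φ, Ψₙ₊₁(η, ξ)⟩.

Iterating this relation moves all entries of ξ onto the smooth test vector φ, so ⟨φ, Ψₙ(ξ)⟩ is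
continuous in ξ. Testing against the dense set of smooth vectors, Baire's theorem on the Fréchet
space Eⁿ gives a bound for Ψₙ on some open set, and multilinearity upgrades this to continuity
(`multilinear_continuous_of_weak`).

The relation also says that the orbit map of Ψₙ(ξ) is weakly differentiable, with derivative
ρ(g)Ψₙ₊₁(η, ξ), where η is the left logarithmic derivative of the chart. As this is continuous, a
mean value estimate uniform in the test vector makes the differentiability strong
(`IsSmoothRep.hasDirDerivAt_of_weak`). The derivative has the same form one level up, so induction
gives all orders (`ckOn_of_weakJet`).

A strongly Cauchy filter is weakly Cauchy, since singletons are bounded. Its weak limit is also its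
strong limit, because the uniform Cauchy estimates survive the pointwise passage to the limit. -/

namespace LCLie

set_option linter.unusedSectionVars false

universe u v w

/-! ### Directional derivatives: mean value theorem and chain rule -/

section DirectionalDerivative

variable {E F : Type*} [AddCommGroup E] [Module ℝ E] [TopologicalSpace E]
  [AddCommGroup F] [Module ℝ F] [TopologicalSpace F]

theorem HasDirDerivAt.unique [T2Space F] {f : E → F} {a b : F} {x v : E}
    (ha : HasDirDerivAt f a x v) (hb : HasDirDerivAt f b x v) : a = b :=
  tendsto_nhds_unique ha hb

theorem tendsto_line [IsTopologicalAddGroup E] [ContinuousSMul ℝ E] (x v : E) :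
    Tendsto (fun t : ℝ => x + t • v) (𝓝[≠] 0) (𝓝 x) := by
  have h : Continuous fun t : ℝ => x + t • v := by fun_prop
  simpa using (h.tendsto 0).mono_left nhdsWithin_le_nhds

theorem HasDirDerivAt.congr_of_eventuallyEq [IsTopologicalAddGroup E] [ContinuousSMul ℝ E]
    {f g : E → F} {a : F} {x v : E}
    (hf : HasDirDerivAt f a x v) (h : f =ᶠ[𝓝 x] g) : HasDirDerivAt g a x v := by
  refine Tendsto.congr' ?_ hf
  filter_upwards [(tendsto_line x v).eventually h] with t ht
  rw [ht, h.self_of_nhds]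

theorem HasDirDerivAt.smul_direction [ContinuousConstSMul ℝ F] {f : E → F} {a : F} {x v : E}
    (hf : HasDirDerivAt f a x v) (c : ℝ) : HasDirDerivAt f (c • a) x (c • v) := by
  rcases eq_or_ne c 0 with rfl | hc
  · simpa [HasDirDerivAt] using tendsto_const_nhds
  have h1 : Tendsto (fun t : ℝ => t * c) (𝓝[≠] 0) (𝓝[≠] 0) := by
    refine tendsto_nhdsWithin_iff.2 ⟨?_, ?_⟩
    · have : Continuous fun t : ℝ => t * c := by fun_prop
      simpa using (this.tendsto 0).mono_left nhdsWithin_le_nhds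
    · filter_upwards [self_mem_nhdsWithin] with t ht
      exact mul_ne_zero ht hc
  refine ((hf.comp h1).const_smul c).congr fun t => ?_
  simp only [Function.comp, smul_smul, mul_inv]
  congr 1
  field_simp

/-- Mean value theorem by separation: were the increment outside `W`, a continuous functional would
separate it strictly from `W`, against the scalar mean value theorem for `l ∘ c`. No integral is
formed, so `F` need not be complete. -/
theorem sub_mem_of_deriv_mem [IsTopologicalAddGroup F] [ContinuousSMul ℝ F]
    [LocallyConvexSpace ℝ F] {W : Set F} (hW : Convex ℝ W) (hWc : IsClosed W) {c c' : ℝ → F}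
    (hc : ∀ s ∈ Icc (0 : ℝ) 1, HasDirDerivAt c (c' s) s 1) (hc' : ∀ s ∈ Icc (0 : ℝ) 1, c' s ∈ W) :
    c 1 - c 0 ∈ W := by
  by_contra hn
  obtain ⟨l, u, hl, hu⟩ := geometric_hahn_banach_closed_point hW hWc hn
  have hd : ∀ s ∈ Icc (0 : ℝ) 1, HasDerivAt (fun s => l (c s)) (l (c' s)) s := by
    intro s hs
    rw [hasDerivAt_iff_tendsto_slope_zero]
    refine ((l.continuous.tendsto _).comp (hc s hs)).congr fun t => ?_
    simp
  obtain ⟨s, hs, hs'⟩ := exists_hasDerivAt_eq_slope (fun s => l (c s)) (fun s => l (c' s))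
    zero_lt_one (fun s hs => (hd s hs).continuousAt.continuousWithinAt)
    (fun s hs => hd s (Ioo_subset_Icc_self hs))
  have h1 := hl _ (hc' s (Ioo_subset_Icc_self hs))
  simp only [sub_zero, div_one] at hs'
  rw [map_sub] at hu
  linarith

theorem exists_isClosed_convex_nhds [IsTopologicalAddGroup F] [ContinuousSMul ℝ F]
    [LocallyConvexSpace ℝ F] {a : F} {N : Set F} (hN : N ∈ 𝓝 a) :
    ∃ W ∈ 𝓝 a, IsClosed W ∧ Convex ℝ W ∧ W ⊆ N := by
  obtain ⟨N', ⟨hN', hc⟩, hs⟩ := (closed_nhds_basis a).mem_iff.1 hN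
  obtain ⟨V, ⟨hV, hVc⟩, hVs⟩ := (LocallyConvexSpace.convex_basis (𝕜 := ℝ) a).mem_iff.1 hN'
  exact ⟨closure V, mem_of_superset hV subset_closure, isClosed_closure, hVc.closure,
    (closure_minimal hVs hc).trans hs⟩

/-- If the directional derivatives of `f` are continuous at `(x, v)`, then the difference
quotients converge uniformly in the base point and the direction. -/
theorem tendsto_diffQuot [IsTopologicalAddGroup E] [ContinuousSMul ℝ E]
    [IsTopologicalAddGroup F] [ContinuousSMul ℝ F] [LocallyConvexSpace ℝ F]
    {f : E → F} {df : E × E → F} {U : Set E} {x v : E} (hU : U ∈ 𝓝 x)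
    (hd : ∀ y ∈ U, ∀ w, HasDirDerivAt f (df (y, w)) y w) (hc : ContinuousAt df (x, v)) :
    Tendsto (fun q : ℝ × E × E => q.1⁻¹ • (f (q.2.1 + q.1 • q.2.2) - f q.2.1))
      (𝓝[≠] 0 ×ˢ 𝓝 (x, v)) (𝓝 (df (x, v))) := by
  intro N hN
  obtain ⟨W, hW, hWc, hWconv, hWN⟩ := exists_isClosed_convex_nhds hN
  have hcont : Continuous fun q : ℝ × E × E => (q.2.1 + q.1 • q.2.2, q.2.2) := by fun_prop
  have h0 : Tendsto (fun q : ℝ × E × E => (q.2.1 + q.1 • q.2.2, q.2.2)) (𝓝 (0, x, v))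
      (𝓝 (x, v)) := by simpa using hcont.tendsto (0, x, v)
  have h1 : ∀ᶠ q : ℝ × E × E in 𝓝 (0, x, v),
      q.2.1 + q.1 • q.2.2 ∈ U ∧ df (q.2.1 + q.1 • q.2.2, q.2.2) ∈ W :=
    (((continuous_fst.tendsto (x, v)).comp h0).eventually hU).and ((hc.tendsto.comp h0) hW)
  rw [nhds_prod_eq] at h1
  obtain ⟨A, hA, B, hB, hAB⟩ := mem_prod_iff.1 h1
  obtain ⟨δ, hδ, hδA⟩ := Metric.mem_nhds_iff.1 hA
  refine mem_map.2 (mem_prod_iff.2 ⟨Metric.ball 0 δ ∩ {0}ᶜ,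
    inter_mem (mem_nhdsWithin_of_mem_nhds (Metric.ball_mem_nhds _ hδ)) self_mem_nhdsWithin,
    B, hB, ?_⟩)
  rintro ⟨t, y, k⟩ ⟨⟨ht, ht0⟩, hyk⟩
  refine hWN ?_
  have key : ∀ s ∈ Icc (0 : ℝ) 1, y + (s * t) • k ∈ U ∧ df (y + (s * t) • k, k) ∈ W := by
    intro s hs
    refine hAB (show (s * t, y, k) ∈ A ×ˢ B from ⟨hδA ?_, hyk⟩)
    rw [mem_ball_zero_iff] at ht ⊢
    rw [norm_mul]
    refine lt_of_le_of_lt (mul_le_of_le_one_left (norm_nonneg _) ?_) ht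
    rw [Real.norm_eq_abs, abs_le]
    exact ⟨by linarith [hs.1], hs.2⟩
  -- The increment over `[0, 1]` of this rescaled path is exactly the difference quotient.
  have := sub_mem_of_deriv_mem (F := F) hWconv hWc (c := fun s => t⁻¹ • f (y + (s * t) • k))
    (c' := fun s => df (y + (s * t) • k, k)) ?_ (fun s hs => (key s hs).2)
  · simpa [← smul_sub] using this
  · intro s hs
    have h2 := (hd _ (key s hs).1 k).smul_direction t
    rw [show df (y + (s * t) • k, k) = t⁻¹ • t • df (y + (s * t) • k, k) by
      rw [inv_smul_smul₀ ht0]]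
    refine (Tendsto.const_smul h2 t⁻¹).congr fun τ => ?_
    simp only [smul_eq_mul, mul_one, add_mul, add_smul, smul_sub, smul_smul, add_assoc]
    simp only [mul_comm]

/-- The quotient of the composite is the quotient of `f` at `g x` in the moving direction `t⁻¹ • (g
(x + t • v) - g x)`, so the uniform convergence in `tendsto_diffQuot` suffices. -/
theorem HasDirDerivAt.comp [IsTopologicalAddGroup E] [ContinuousSMul ℝ E]
    [IsTopologicalAddGroup F] [ContinuousSMul ℝ F] [LocallyConvexSpace ℝ F]
    {E₀ : Type*} [AddCommGroup E₀] [Module ℝ E₀]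
    {f : E → F} {df : E × E → F} {U : Set E} {g : E₀ → E} {g' : E} {x v : E₀} (hU : U ∈ 𝓝 (g x))
    (hd : ∀ y ∈ U, ∀ w, HasDirDerivAt f (df (y, w)) y w) (hc : ContinuousAt df (g x, g'))
    (hg : HasDirDerivAt g g' x v) : HasDirDerivAt (fun y => f (g y)) (df (g x, g')) x v := by
  have h1 : Tendsto (fun t : ℝ => (t, g x, t⁻¹ • (g (x + t • v) - g x))) (𝓝[≠] 0)
      (𝓝[≠] 0 ×ˢ 𝓝 (g x, g')) :=
    tendsto_id.prodMk (tendsto_const_nhds.prodMk_nhds hg)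
  refine ((tendsto_diffQuot hU hd hc).comp h1).congr' ?_
  filter_upwards [self_mem_nhdsWithin] with t ht
  simp [smul_inv_smul₀ (show t ≠ 0 from ht)]

/-- The increment is split at `x + t • v`. The second part has a moving base point, which
`tendsto_diffQuot` allows. -/
theorem HasDirDerivAt.add_direction [T2Space F] [IsTopologicalAddGroup E] [ContinuousSMul ℝ E]
    [IsTopologicalAddGroup F] [ContinuousSMul ℝ F] [LocallyConvexSpace ℝ F]
    {f : E → F} {df : E × E → F} {U : Set E} {x v w : E} (hU : U ∈ 𝓝 x)
    (hd : ∀ y ∈ U, ∀ w, HasDirDerivAt f (df (y, w)) y w) (hc : ContinuousAt df (x, w)) :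
    df (x, v + w) = df (x, v) + df (x, w) := by
  refine (hd x (mem_of_mem_nhds hU) (v + w)).unique ?_
  have h1 : Tendsto (fun t : ℝ => (t, x + t • v, w)) (𝓝[≠] 0) (𝓝[≠] 0 ×ˢ 𝓝 (x, w)) :=
    tendsto_id.prodMk ((tendsto_line x v).prodMk_nhds tendsto_const_nhds)
  refine ((hd x (mem_of_mem_nhds hU) v).add ((tendsto_diffQuot hU hd hc).comp h1)).congr fun t => ?_
  simp only [Function.comp, ← smul_add, add_assoc]
  congr 1
  abel

end DirectionalDerivative

/-! ### Finite-order differentiability through iterated tangent maps -/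

section FiniteOrder

variable {E : Type u} [AddCommGroup E] [Module ℝ E] [TopologicalSpace E]
  {E' : Type v} [AddCommGroup E'] [Module ℝ E'] [TopologicalSpace E']
  {F : Type w} [AddCommGroup F] [Module ℝ F] [TopologicalSpace F]

/-- The directional derivative of `f`, as a map on pairs of a point and a direction. -/
noncomputable def dirDeriv (f : E → F) (p : E × E) : F :=
  limUnder (𝓝[≠] (0 : ℝ)) fun t => t⁻¹ • (f (p.1 + t • p.2) - f p.1)

/-- `f` is of class `C^n` on `U` (with `n` finite), defined through iterated tangent maps. -/
def CkOn {F : Type w} [AddCommGroup F] [Module ℝ F] [TopologicalSpace F] :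
    ℕ → ∀ {E : Type u} [AddCommGroup E] [Module ℝ E] [TopologicalSpace E], (E → F) → Set E → Prop
  | 0, _, _, _, _, f, U => ContinuousOn f U
  | n + 1, _, _, _, _, f, U => ContinuousOn f U ∧
      (∀ x ∈ U, ∀ v, HasDirDerivAt f (dirDeriv f (x, v)) x v) ∧ CkOn n (dirDeriv f) (U ×ˢ univ)

theorem HasDirDerivAt.dirDeriv_eq [T2Space F] {f : E → F} {a : F} {x v : E}
    (h : HasDirDerivAt f a x v) : dirDeriv f (x, v) = a :=
  h.limUnder_eq

theorem CkOn.continuousOn {n : ℕ} {f : E → F} {U : Set E} (h : CkOn n f U) :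
    ContinuousOn f U := by
  cases n with
  | zero => exact h
  | succ n => exact h.1

theorem CkOn.mono {n : ℕ} {f : E → F} {U V : Set E} (h : CkOn n f U) (hV : V ⊆ U) :
    CkOn n f V := by
  induction n generalizing E with
  | zero => exact ContinuousOn.mono h hV
  | succ n ih =>
    exact ⟨h.1.mono hV, fun x hx => h.2.1 x (hV hx), ih h.2.2 (prod_mono hV subset_rfl)⟩

theorem CkOn.of_succ {n : ℕ} {f : E → F} {U : Set E} (h : CkOn (n + 1) f U) : CkOn n f U := by
  induction n generalizing E with
  | zero => exact h.1
  | succ n ih => exact ⟨h.1, h.2.1, ih h.2.2⟩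

theorem CkOn.of_locally {n : ℕ} {f : E → F} {U : Set E}
    (h : ∀ x ∈ U, ∃ V, IsOpen V ∧ x ∈ V ∧ CkOn n f V) : CkOn n f U := by
  induction n generalizing E with
  | zero =>
    intro x hx
    obtain ⟨V, hV, hxV, hf⟩ := h x hx
    exact (ContinuousOn.continuousAt hf (hV.mem_nhds hxV)).continuousWithinAt
  | succ n ih =>
    refine ⟨fun x hx => ?_, fun x hx => ?_, ih ?_⟩
    · obtain ⟨V, hV, hxV, hf⟩ := h x hx
      exact (hf.1.continuousAt (hV.mem_nhds hxV)).continuousWithinAt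
    · obtain ⟨V, hV, hxV, hf⟩ := h x hx
      exact hf.2.1 x hxV
    · rintro ⟨x, v⟩ hx
      obtain ⟨V, hV, hxV, hf⟩ := h x hx.1
      exact ⟨V ×ˢ univ, hV.prod isOpen_univ, ⟨hxV, trivial⟩, hf.2.2⟩

variable [IsTopologicalAddGroup E] [ContinuousSMul ℝ E]
  [IsTopologicalAddGroup E'] [ContinuousSMul ℝ E']

theorem dirDeriv_congr {f g : E → F} {U : Set E} (hU : IsOpen U) (h : EqOn f g U) :
    EqOn (dirDeriv f) (dirDeriv g) (U ×ˢ univ) := by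
  rintro ⟨x, v⟩ ⟨hx, -⟩
  unfold dirDeriv limUnder
  congr 1
  refine Filter.map_congr ?_
  filter_upwards [(tendsto_line x v).eventually (hU.mem_nhds hx)] with t ht
  rw [h ht, h hx]

theorem CkOn.congr {n : ℕ} {f g : E → F} {U : Set E} (hU : IsOpen U) (hf : CkOn n f U)
    (h : EqOn f g U) : CkOn n g U := by
  induction n generalizing E with
  | zero => exact ContinuousOn.congr hf h.symm
  | succ n ih =>
    refine ⟨hf.1.congr h.symm, fun x hx v => ?_,
      ih (hU.prod isOpen_univ) hf.2.2 (dirDeriv_congr hU h)⟩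
    rw [← dirDeriv_congr hU h (show (x, v) ∈ U ×ˢ univ from ⟨hx, trivial⟩)]
    exact (hf.2.1 x hx v).congr_of_eventuallyEq (h.eventuallyEq_of_mem (hU.mem_nhds hx))

variable [T2Space F]

/-- Since `dirDeriv` is determined by `f` on the open set, any explicit formula for the derivative
may replace it. This is how the inductive steps below are carried out. -/
theorem CkOn.of_hasDirDerivAt {n : ℕ} {f : E → F} {f' : E × E → F} {U : Set E} (hU : IsOpen U)
    (hf : ContinuousOn f U) (hd : ∀ x ∈ U, ∀ v, HasDirDerivAt f (f' (x, v)) x v)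
    (hf' : CkOn n f' (U ×ˢ univ)) : CkOn (n + 1) f U := by
  have h : EqOn f' (dirDeriv f) (U ×ˢ univ) := fun p hp => ((hd p.1 hp.1 p.2).dirDeriv_eq).symm
  exact ⟨hf, fun x hx v => h (show (x, v) ∈ U ×ˢ univ from ⟨hx, trivial⟩) ▸ hd x hx v,
    hf'.congr (hU.prod isOpen_univ) h⟩

theorem ckOn_const (n : ℕ) (c : F) (U : Set E) (hU : IsOpen U) : CkOn n (fun _ : E => c) U := by
  induction n generalizing E c with
  | zero => exact continuousOn_const
  | succ n ih =>
    refine .of_hasDirDerivAt (f' := fun _ => 0) hU continuousOn_const (fun x _ v => ?_)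
      (ih _ _ (hU.prod isOpen_univ))
    simp [HasDirDerivAt]

theorem hasDirDerivAt_clm (L : E →L[ℝ] F) (x v : E) : HasDirDerivAt L (L v) x v := by
  refine Tendsto.congr' ?_ tendsto_const_nhds
  filter_upwards [self_mem_nhdsWithin] with t ht
  simp [inv_smul_smul₀ (show t ≠ 0 from ht)]

theorem ckOn_clm (n : ℕ) (L : E →L[ℝ] F) (U : Set E) (hU : IsOpen U) : CkOn n L U := by
  induction n generalizing E with
  | zero => exact L.continuous.continuousOn
  | succ n ih =>
    exact .of_hasDirDerivAt (f' := L.comp (ContinuousLinearMap.snd ℝ E E)) hU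
      L.continuous.continuousOn (fun x _ v => hasDirDerivAt_clm L x v)
      (ih _ _ (hU.prod isOpen_univ))

theorem CkOn.comp_clm {n : ℕ} {f : E' → F} {U : Set E'} (hU : IsOpen U) (hf : CkOn n f U)
    (L : E →L[ℝ] E') : CkOn n (fun x => f (L x)) (L ⁻¹' U) := by
  induction n generalizing E E' with
  | zero => exact ContinuousOn.comp hf L.continuous.continuousOn fun _ hx => hx
  | succ n ih =>
    refine .of_hasDirDerivAt (f' := fun p => dirDeriv f (L.prodMap L p))
      (hU.preimage L.continuous) (hf.1.comp L.continuous.continuousOn fun _ hx => hx)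
      (fun x hx v => ?_) ?_
    · refine (hf.2.1 (L x) hx (L v)).congr fun t => ?_
      simp
    · exact (ih (hU.prod isOpen_univ) hf.2.2 (L.prodMap L)).mono fun p hp => ⟨hp.1, trivial⟩

theorem CkOn.prodMk {F' : Type*} [AddCommGroup F'] [Module ℝ F'] [TopologicalSpace F']
    [T2Space F'] {n : ℕ} {f : E → F} {g : E → F'} {U : Set E} (hU : IsOpen U) (hf : CkOn n f U)
    (hg : CkOn n g U) : CkOn n (fun x => (f x, g x)) U := by
  induction n generalizing E with
  | zero => exact ContinuousOn.prodMk hf hg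
  | succ n ih =>
    refine .of_hasDirDerivAt (f' := fun p => (dirDeriv f p, dirDeriv g p)) hU
      (hf.1.prodMk hg.1) (fun x hx v => ?_) (ih (hU.prod isOpen_univ) hf.2.2 hg.2.2)
    exact (hf.2.1 x hx v).prodMk_nhds (hg.2.1 x hx v)

variable [IsTopologicalAddGroup F] [ContinuousSMul ℝ F] [LocallyConvexSpace ℝ F] [T2Space E']

/-- The derivative `dirDeriv f (g x, dirDeriv g (x, v))` is again a composite of maps of one order
less, so the induction runs over all spaces at once. -/
theorem CkOn.comp {n : ℕ} {f : E' → F} {g : E → E'} {U : Set E} {V : Set E'} (hU : IsOpen U)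
    (hV : IsOpen V) (hf : CkOn n f V) (hg : CkOn n g U) (hUV : MapsTo g U V) :
    CkOn n (fun x => f (g x)) U := by
  induction n generalizing E E' with
  | zero => exact ContinuousOn.comp hf hg hUV
  | succ n ih =>
    refine .of_hasDirDerivAt (f' := fun p => dirDeriv f (g p.1, dirDeriv g p)) hU
      (hf.1.comp hg.1 hUV) (fun x hx v => ?_) ?_
    · exact (hg.2.1 x hx v).comp (df := dirDeriv f) (hV.mem_nhds (hUV hx)) hf.2.1
        (hf.2.2.continuousOn.continuousAt
          ((hV.prod isOpen_univ).mem_nhds ⟨hUV hx, trivial⟩))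
    · refine ih (hU.prod isOpen_univ) (hV.prod isOpen_univ) hf.2.2
        (CkOn.prodMk (hU.prod isOpen_univ) ?_ hg.2.2) fun p hp => ⟨hUV hp.1, trivial⟩
      exact (hg.of_succ.comp_clm hU (ContinuousLinearMap.fst ℝ E E)).mono fun p hp => hp.1

theorem CkOn.sum {n : ℕ} {ι : Type*} (s : Finset ι) {f : ι → E → F} {U : Set E} (hU : IsOpen U)
    (hf : ∀ i ∈ s, CkOn n (f i) U) : CkOn n (fun x => ∑ i ∈ s, f i x) U := by
  classical
  induction s using Finset.induction_on with
  | empty => simpa using ckOn_const n (0 : F) U hU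
  | insert i s hi ih =>
    simp only [Finset.sum_insert hi]
    exact (ckOn_clm n (ContinuousLinearMap.fst ℝ F F + ContinuousLinearMap.snd ℝ F F) univ
      isOpen_univ).comp hU isOpen_univ (CkOn.prodMk hU (hf i (Finset.mem_insert_self i s))
        (ih fun j hj => hf j (Finset.mem_insert_of_mem hj))) (mapsTo_univ _ _)

theorem CkOn.add {n : ℕ} {f g : E → F} {U : Set E} (hU : IsOpen U) (hf : CkOn n f U)
    (hg : CkOn n g U) : CkOn n (fun x => f x + g x) U :=
  (ckOn_clm n (ContinuousLinearMap.fst ℝ F F + ContinuousLinearMap.snd ℝ F F) univ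
      isOpen_univ).comp hU isOpen_univ (hf.prodMk hU hg) (mapsTo_univ _ _)

/-- Allowing the direction to vary with `t` covers curves of which only the velocity at `0` is
known. -/
theorem CkOn.hasDirDerivAt_of_tendsto {f : E → F} {U : Set E} {x v : E} (hU : IsOpen U)
    (hx : x ∈ U) (hf : CkOn 1 f U) {k : ℝ → E} (hk : Tendsto k (𝓝[≠] 0) (𝓝 v)) :
    Tendsto (fun t : ℝ => t⁻¹ • (f (x + t • k t) - f x)) (𝓝[≠] 0) (𝓝 (dirDeriv f (x, v))) :=
  (tendsto_diffQuot (hU.mem_nhds hx) hf.2.1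
    (hf.2.2.continuousOn.continuousAt ((hU.prod isOpen_univ).mem_nhds ⟨hx, trivial⟩))).comp
    (tendsto_id.prodMk (tendsto_const_nhds.prodMk_nhds hk))

theorem CkOn.dirDeriv_add {f : E → F} {U : Set E} (hU : IsOpen U) (hf : CkOn 1 f U) {x : E}
    (hx : x ∈ U) (v w : E) : dirDeriv f (x, v + w) = dirDeriv f (x, v) + dirDeriv f (x, w) :=
  HasDirDerivAt.add_direction (hU.mem_nhds hx) hf.2.1
    (hf.2.2.continuousOn.continuousAt ((hU.prod isOpen_univ).mem_nhds ⟨hx, trivial⟩))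

theorem CkOn.dirDeriv_smul {f : E → F} {U : Set E} (hf : CkOn 1 f U) {x : E}
    (hx : x ∈ U) (c : ℝ) (v : E) : dirDeriv f (x, c • v) = c • dirDeriv f (x, v) :=
  ((hf.2.1 x hx v).smul_direction c).dirDeriv_eq

end FiniteOrder

/-! ### Families of multilinear maps -/

section Multilinear

variable {X : Type u} [AddCommGroup X] [Module ℝ X] [TopologicalSpace X]
  {E : Type v} [AddCommGroup E] [Module ℝ E] [TopologicalSpace E]
  {F : Type w} [AddCommGroup F] [Module ℝ F] [TopologicalSpace F]
  [IsTopologicalAddGroup X] [ContinuousSMul ℝ X]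
  [IsTopologicalAddGroup E] [ContinuousSMul ℝ E]
  [IsTopologicalAddGroup F] [ContinuousSMul ℝ F]

theorem hasDirDerivAt_multilinear {n : ℕ} {M : X → (Fin n → E) → F} {U : Set X} {x v : X}
    {h w : Fin n → E} {d : F} (hU : U ∈ 𝓝 x)
    (hM : ∀ y ∈ U, ∃ m : MultilinearMap ℝ (fun _ : Fin n => E) F, ⇑m = M y)
    (hc : ∀ h, ContinuousAt (fun p : X × (Fin n → E) => M p.1 p.2) (x, h))
    (hd : HasDirDerivAt (fun y => M y h) d x v) :
    HasDirDerivAt (fun p : X × (Fin n → E) => M p.1 p.2)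
      (d + ∑ i, M x (Function.update h i (w i))) (x, h) (v, w) := by
  -- Entries of `h` are shifted one at a time; by multilinearity each shift contributes exactly one
  -- summand to the quotient, whose limit is given by joint continuity.
  have key : ∀ S : Finset (Fin n), Tendsto
      (fun t : ℝ => t⁻¹ • (M (x + t • v) (S.piecewise (h + t • w) h) - M (x + t • v) h))
      (𝓝[≠] 0) (𝓝 (∑ i ∈ S, M x (Function.update h i (w i)))) := by
    intro S
    induction S using Finset.induction_on with
    | empty => simpa using tendsto_const_nhds
    | insert i S hi ih =>
      rw [Finset.sum_insert hi]
      have hcont : Continuous fun t : ℝ =>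
          (x + t • v, Function.update (S.piecewise (h + t • w) h) i (w i)) := by
        refine .prodMk (by fun_prop) (Continuous.update ?_ i continuous_const)
        refine continuous_pi fun j => ?_
        by_cases hj : j ∈ S
        · simpa [hj] using by fun_prop
        · simpa [hj] using continuous_const
      have h1 : Tendsto (fun t : ℝ =>
          M (x + t • v) (Function.update (S.piecewise (h + t • w) h) i (w i)))
          (𝓝[≠] 0) (𝓝 (M x (Function.update h i (w i)))) := by
        have h2 := (hcont.tendsto 0).mono_left (nhdsWithin_le_nhds (s := {0}ᶜ))
        simp only [zero_smul, add_zero, Finset.piecewise_same] at h2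
        exact (hc _).tendsto.comp h2
      refine (h1.add ih).congr' ?_
      filter_upwards [(tendsto_line x v).eventually hU, self_mem_nhdsWithin] with t ht ht0
      obtain ⟨m, hm⟩ := hM _ ht
      rw [← hm, Finset.piecewise_insert]
      set a := S.piecewise (h + t • w) h
      have ha : m (Function.update a i ((h + t • w) i)) =
          m a + t • m (Function.update a i (w i)) := by
        have : h i = a i := by simp [a, hi]
        rw [Pi.add_apply, Pi.smul_apply, m.map_update_add, m.map_update_smul, this,
          Function.update_eq_self]
      rw [ha, add_comm (m a), add_sub_assoc, smul_add, inv_smul_smul₀ ht0]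
  refine (hd.add (key Finset.univ)).congr fun t => ?_
  rw [← smul_add]
  simp

/-- Taking the derivative only raises the order of differentiability in the first argument. -/
theorem CkOn.succ_of_multilinear [T2Space F] [LocallyConvexSpace ℝ F] {k n : ℕ}
    {M : X → (Fin n → E) → F} {M' : X → X → (Fin n → E) → F} {U : Set X} (hU : IsOpen U)
    (hM : ∀ y ∈ U, ∃ m : MultilinearMap ℝ (fun _ : Fin n => E) F, ⇑m = M y)
    (hd : ∀ x ∈ U, ∀ v h, HasDirDerivAt (fun y => M y h) (M' x v h) x v)
    (hk : CkOn k (fun p : X × (Fin n → E) => M p.1 p.2) (U ×ˢ univ))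
    (hk' : CkOn k (fun p : (X × (Fin n → E)) × (X × (Fin n → E)) => M' p.1.1 p.2.1 p.1.2)
      ((U ×ˢ univ) ×ˢ univ)) :
    CkOn (k + 1) (fun p : X × (Fin n → E) => M p.1 p.2) (U ×ˢ univ) := by
  have hUo : IsOpen (U ×ˢ (univ : Set (Fin n → E))) := hU.prod isOpen_univ
  refine .of_hasDirDerivAt (f' := fun p => M' p.1.1 p.2.1 p.1.2 +
    ∑ i, M p.1.1 (Function.update p.1.2 i (p.2.2 i))) hUo hk.continuousOn ?_ ?_
  · rintro ⟨x, h⟩ ⟨hx, -⟩ ⟨v, w⟩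
    exact hasDirDerivAt_multilinear (hU.mem_nhds hx) hM
      (fun h => hk.continuousOn.continuousAt (hUo.mem_nhds ⟨hx, trivial⟩)) (hd x hx v h)
  · refine hk'.add (hUo.prod isOpen_univ) (CkOn.sum _ (hUo.prod isOpen_univ) fun i _ => ?_)
    -- The summands of the derivative in the tuple are `M` composed with linear maps, so they
    -- inherit the order `k` of `M`.
    let L : ((X × (Fin n → E)) × (X × (Fin n → E))) →L[ℝ] X × (Fin n → E) :=
      { toFun := fun p => (p.1.1, Function.update p.1.2 i (p.2.2 i))
        map_add' := fun p q => by
          refine Prod.ext rfl ?_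
          simp [← Function.update_add]
        map_smul' := fun c p => by
          refine Prod.ext rfl ?_
          simp [← Function.update_smul]
        cont := by
          refine Continuous.prodMk (by fun_prop) (Continuous.update (by fun_prop) i ?_)
          exact (continuous_apply i).comp (continuous_snd.comp continuous_snd) }
    exact (hk.comp_clm hUo L).mono fun p hp => ⟨hp.1.1, trivial⟩

end Multilinear

/-! ### Equivalence of the two notions of smoothness -/

section Comparison

variable {E : Type u} [AddCommGroup E] [Module ℝ E] [TopologicalSpace E]
  {F : Type w} [AddCommGroup F] [Module ℝ F] [TopologicalSpace F]
  [IsTopologicalAddGroup E] [ContinuousSMul ℝ E]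
  [IsTopologicalAddGroup F] [ContinuousSMul ℝ F] [T2Space F] [LocallyConvexSpace ℝ F]

/-- The last entry is the direction of the newest derivative, where linearity comes from
`HasDirDerivAt.add_direction` and `HasDirDerivAt.smul_direction`. In the other entries it passes to
the limit from the previous order. -/
theorem exists_multilinearMap_iteratedDeriv {f : E → F} {U : Set E} (hU : IsOpen U)
    {D : (j : ℕ) → E → (Fin j → E) → F} (h0 : ∀ x ∈ U, ∀ h : Fin 0 → E, D 0 x h = f x)
    (h1 : ∀ (j : ℕ), ∀ x ∈ U, ∀ (h : Fin j → E) (v : E),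
      HasDirDerivAt (fun y => D j y h) (D (j + 1) x (Fin.snoc h v)) x v)
    (h2 : ∀ j : ℕ, ContinuousOn (fun p : E × (Fin j → E) => D j p.1 p.2) (U ×ˢ univ))
    (j : ℕ) : ∀ x ∈ U, ∃ m : MultilinearMap ℝ (fun _ : Fin j => E) F, ⇑m = D j x := by
  induction j with
  | zero =>
    intro x hx
    exact ⟨MultilinearMap.constOfIsEmpty ℝ _ (f x), funext fun h => (h0 x hx h).symm⟩
  | succ j ih =>
    intro x hx
    have hlin : ∀ (h : Fin j → E) (v w : E),
        D (j + 1) x (Fin.snoc h (v + w)) = D (j + 1) x (Fin.snoc h v) + D (j + 1) x (Fin.snoc h w) :=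
      fun h v w => HasDirDerivAt.add_direction (f := fun y => D j y h)
        (df := fun p => D (j + 1) p.1 (Fin.snoc h p.2)) (hU.mem_nhds hx)
        (fun y hy w => h1 j y hy h w) <| by
          have := (h2 (j + 1)).continuousAt
            ((hU.prod isOpen_univ).mem_nhds (show (x, Fin.snoc h w) ∈ U ×ˢ univ from ⟨hx, trivial⟩))
          refine ContinuousAt.comp (f := fun p : E × E => (p.1, (Fin.snoc h p.2 : Fin (j+1) → E)))
            (x := (x, w)) this ?_
          exact Continuous.continuousAt (by fun_prop)
    refine ⟨MultilinearMap.mk' (D (j + 1) x) ?_ ?_, rfl⟩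
    · intro h i v w
      rw [← Fin.snoc_init_self h]
      refine Fin.lastCases ?_ (fun i => ?_) i
      · simp only [Fin.update_snoc_last, hlin]
      · simp only [← Fin.snoc_update]
        refine (h1 j x hx _ _).unique ?_
        refine ((h1 j x hx _ _).add (h1 j x hx _ _)).congr' ?_
        filter_upwards [(tendsto_line x (h (Fin.last j))).eventually (hU.mem_nhds hx)] with t ht
        obtain ⟨m, hm⟩ := ih x hx
        obtain ⟨m', hm'⟩ := ih _ ht
        rw [← hm, ← hm', ← smul_add, m.map_update_add, m'.map_update_add]
        congr 1
        abel
    · intro h i c v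
      rw [← Fin.snoc_init_self h]
      refine Fin.lastCases ?_ (fun i => ?_) i
      · simp only [Fin.update_snoc_last]
        exact (h1 j x hx _ _).unique ((h1 j x hx _ _).smul_direction c)
      · simp only [← Fin.snoc_update]
        refine (h1 j x hx _ _).unique ?_
        refine (Tendsto.const_smul (h1 j x hx _ _) c).congr' ?_
        filter_upwards [(tendsto_line x (h (Fin.last j))).eventually (hU.mem_nhds hx)] with t ht
        obtain ⟨m, hm⟩ := ih x hx
        obtain ⟨m', hm'⟩ := ih _ ht
        rw [← hm, ← hm', m.map_update_smul, m'.map_update_smul, ← smul_sub, smul_comm]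

/-- The induction treats all `D j` simultaneously: the derivative of `D j` in the base point is `D
(j + 1)`, and multilinearity accounts for the remaining arguments. -/
theorem SmoothOn.ckOn {f : E → F} {U : Set E} (hU : IsOpen U) (hf : SmoothOn f U) (n : ℕ) :
    CkOn n f U := by
  obtain ⟨D, h0, h1, h2⟩ := hf
  have key : ∀ j, CkOn n (fun p : E × (Fin j → E) => D j p.1 p.2) (U ×ˢ univ) := by
    induction n with
    | zero => exact h2
    | succ n ih =>
      intro j
      refine .succ_of_multilinear hU (exists_multilinearMap_iteratedDeriv hU h0 h1 h2 j)
        (M' := fun x v h => D (j + 1) x (Fin.snoc h v)) (fun x hx v h => h1 j x hx h v) (ih j) ?_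
      let L : ((E × (Fin j → E)) × (E × (Fin j → E))) →L[ℝ] E × (Fin (j + 1) → E) :=
        { toFun := fun p => (p.1.1, Fin.snoc p.1.2 p.2.1)
          map_add' := fun p q => by
            refine Prod.ext rfl (funext fun i => ?_)
            refine Fin.lastCases ?_ (fun i => ?_) i <;> simp
          map_smul' := fun c p => by
            refine Prod.ext rfl (funext fun i => ?_)
            refine Fin.lastCases ?_ (fun i => ?_) i <;> simp
          cont := by fun_prop }
      exact ((ih (j + 1)).comp_clm (hU.prod isOpen_univ) L).mono fun p hp => ⟨hp.1.1, trivial⟩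
  have h3 := (key 0).comp_clm (hU.prod isOpen_univ) (ContinuousLinearMap.inl ℝ E (Fin 0 → E))
  have h4 : (ContinuousLinearMap.inl ℝ E (Fin 0 → E)) ⁻¹' (U ×ˢ univ) = U := by
    ext x; simp
  rw [h4] at h3
  exact h3.congr hU fun x hx => h0 x hx _

/-- The iterated directional derivatives of `f`. -/
noncomputable def iterDirDeriv (f : E → F) : (j : ℕ) → E × (Fin j → E) → F
  | 0 => fun p => f p.1
  | j + 1 => fun p =>
    dirDeriv (iterDirDeriv f j) ((p.1, Fin.init p.2), (p.2 (Fin.last j), 0))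

/-- Each iterated derivative is the tangent derivative of the previous one pulled back along a
linear map; the zero in its direction keeps the earlier directions fixed. -/
theorem smoothOn_of_forall_ckOn {f : E → F} {U : Set E} (hU : IsOpen U)
    (hf : ∀ n, CkOn n f U) : SmoothOn f U := by
  have key : ∀ j n, CkOn n (iterDirDeriv f j) (U ×ˢ univ) := by
    intro j
    induction j with
    | zero =>
      intro n
      exact ((hf n).comp_clm hU (ContinuousLinearMap.fst ℝ E (Fin 0 → E))).mono fun p hp => hp.1
    | succ j ih =>
      intro n
      let L : (E × (Fin (j + 1) → E)) →L[ℝ] (E × (Fin j → E)) × (E × (Fin j → E)) :=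
        { toFun := fun p => ((p.1, Fin.init p.2), (p.2 (Fin.last j), 0))
          map_add' := fun p q => by
            refine Prod.ext rfl (Prod.ext rfl ?_)
            simp
          map_smul' := fun c p => by
            refine Prod.ext rfl (Prod.ext rfl ?_)
            simp
          cont := by fun_prop }
      exact ((ih (n + 1)).2.2.comp_clm ((hU.prod isOpen_univ).prod isOpen_univ) L).mono
        fun p hp => ⟨⟨hp.1, trivial⟩, trivial⟩
  refine ⟨fun j x h => iterDirDeriv f j (x, h), fun x _ h => rfl, fun j x hx h v => ?_,
    fun j => (key j 0).continuousOn⟩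
  have := (key j 1).2.1 (x, h) ⟨hx, trivial⟩ (v, 0)
  simp only [HasDirDerivAt, Prod.smul_mk, smul_zero, Prod.mk_add_mk, add_zero] at this ⊢
  simpa [iterDirDeriv] using this

end Comparison

/-! ### Boundedness and continuity of multilinear maps -/

section LocallyBounded

variable {E : Type*} [AddCommGroup E] [Module ℝ E] [TopologicalSpace E] [IsTopologicalAddGroup E]
  [ContinuousSMul ℝ E] {H : Type*} [NormedAddCommGroup H] [NormedSpace ℝ H] {n : ℕ}
  (Ψ : MultilinearMap ℝ (fun _ : Fin n => E) H)

theorem multilinear_map_smul (c : ℝ) (m : Fin n → E) : Ψ (c • m) = c ^ n • Ψ m := by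
  have h := Ψ.map_smul_univ (fun _ => c) m
  rw [Finset.prod_const, Finset.card_univ, Fintype.card_fin] at h
  exact h

/-- The base point is removed one entry at a time: an entry `h i` is the difference of `a i + h i`
and `a i`, and the latter is the case `h i = 0` of the former. Each removal doubles the bound. -/
theorem multilinear_bounded_near_zero {a : Fin n → E} {C : ℝ} (hC : ∀ᶠ m in 𝓝 a, ‖Ψ m‖ ≤ C) :
    ∃ C', ∀ᶠ m in 𝓝 0, ‖Ψ m‖ ≤ C' := by
  have key : ∀ S : Finset (Fin n),
      ∃ C', ∀ᶠ h : Fin n → E in 𝓝 0, ‖Ψ (S.piecewise h (a + h))‖ ≤ C' := by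
    intro S
    induction S using Finset.induction_on with
    | empty =>
      have h1 : Tendsto (fun h : Fin n → E => a + h) (𝓝 0) (𝓝 a) := by
        have hc : Continuous fun h : Fin n → E => a + h := by fun_prop
        simpa using hc.tendsto 0
      exact ⟨C, by simpa using h1.eventually hC⟩
    | insert i S hi ih =>
      obtain ⟨C', hC'⟩ := ih
      have h1 : Tendsto (fun h : Fin n → E => Function.update h i 0) (𝓝 0) (𝓝 0) := by
        have : Continuous fun h : Fin n → E => Function.update h i 0 :=
          continuous_id.update i continuous_const
        have h2 := this.tendsto 0
        rwa [show Function.update (0 : Fin n → E) i 0 = 0 by simp] at h2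
      refine ⟨C' + C', ?_⟩
      filter_upwards [hC', h1.eventually hC'] with h hh hh'
      rw [Finset.piecewise_insert]
      have e1 : S.piecewise (Function.update h i 0) (a + Function.update h i 0) =
          Function.update (S.piecewise h (a + h)) i (a i) := by
        ext j
        by_cases hj : j = i
        · subst hj; simp [hi]
        · by_cases hS : j ∈ S <;> simp [hj, hS]
      rw [e1] at hh'
      have e2 := Ψ.map_update_add (S.piecewise h (a + h)) i (a i) (h i)
      rw [show a i + h i = S.piecewise h (a + h) i by simp [hi], Function.update_eq_self] at e2
      rw [show Ψ (Function.update (S.piecewise h (a + h)) i (h i)) = Ψ (S.piecewise h (a + h)) -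
        Ψ (Function.update (S.piecewise h (a + h)) i (a i)) by rw [e2]; abel]
      exact (norm_sub_le _ _).trans (add_le_add hh hh')
  simpa using key Finset.univ

/-- By homogeneity: a fixed small multiple `δ • m`, for `m` near `b`, lies where the bound at zero
applies. -/
theorem multilinear_locally_bounded {C : ℝ} (hC : ∀ᶠ m in 𝓝 0, ‖Ψ m‖ ≤ C) (b : Fin n → E) :
    ∃ C', ∀ᶠ m in 𝓝 b, ‖Ψ m‖ ≤ C' := by
  have h1 : Tendsto (fun p : ℝ × (Fin n → E) => p.1 • p.2) (𝓝 0 ×ˢ 𝓝 b) (𝓝 0) := by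
    rw [← nhds_prod_eq]
    have hc : Continuous fun p : ℝ × (Fin n → E) => p.1 • p.2 := by fun_prop
    simpa using hc.tendsto (0, b)
  obtain ⟨p, hp, q, hq, hpq⟩ := eventually_prod_iff.1 (h1.eventually hC)
  obtain ⟨δ, hδ0, hδ⟩ : ∃ δ : ℝ, 0 < δ ∧ p δ := by
    have := (hp.filter_mono (nhdsWithin_le_nhds (s := Ioi 0))).and self_mem_nhdsWithin
    obtain ⟨δ, h1, h2⟩ := this.exists
    exact ⟨δ, h2, h1⟩
  refine ⟨(δ ^ n)⁻¹ * C, ?_⟩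
  filter_upwards [hq] with m hm
  have h2 := hpq hδ hm
  have h3 : Ψ (δ • m) = δ ^ n • Ψ m := multilinear_map_smul Ψ δ m
  rw [h3, norm_smul, Real.norm_of_nonneg (by positivity)] at h2
  rwa [← div_eq_inv_mul, le_div_iff₀' (by positivity)]

theorem multilinear_continuous_of_locally_bounded
    (hb : ∀ b : Fin n → E, ∃ C, ∀ᶠ m in 𝓝 b, ‖Ψ m‖ ≤ C) : Continuous Ψ := by
  -- Local boundedness forces smallness in a single entry, since a factor `s` can be pulled out of
  -- it while the rescaled entry still tends to zero.
  have small : ∀ (i : Fin n) (b : Fin n → E), Tendsto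
      (fun p : (Fin n → E) × E => Ψ (Function.update p.1 i p.2)) (𝓝 (b, 0)) (𝓝 0) := by
    intro i b
    obtain ⟨C, hC⟩ := hb (Function.update b i 0)
    rw [NormedAddGroup.tendsto_nhds_zero]
    intro ε hε
    obtain ⟨s, hs0, hs⟩ : ∃ s : ℝ, 0 < s ∧ s * C < ε := by
      refine ⟨ε / (|C| + 1), by positivity, ?_⟩
      rw [div_mul_eq_mul_div, div_lt_iff₀ (by positivity)]
      exact mul_lt_mul_of_pos_left (by linarith [le_abs_self C]) hε
    have h1 : Continuous fun p : (Fin n → E) × E => Function.update p.1 i (s⁻¹ • p.2) :=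
      continuous_fst.update i (continuous_snd.const_smul _)
    have h2 := h1.tendsto (b, 0)
    simp only [smul_zero] at h2
    filter_upwards [h2.eventually hC] with p hp
    have h3 := Ψ.map_update_smul p.1 i s (s⁻¹ • p.2)
    rw [smul_inv_smul₀ hs0.ne'] at h3
    rw [h3, norm_smul, Real.norm_of_nonneg hs0.le]
    exact (mul_le_mul_of_nonneg_left hp hs0.le).trans_lt hs
  refine continuous_iff_continuousAt.2 fun b => ?_
  have key : ∀ S : Finset (Fin n), Tendsto (fun m => Ψ (S.piecewise m b)) (𝓝 b) (𝓝 (Ψ b)) := by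
    intro S
    induction S using Finset.induction_on with
    | empty => simp
    | insert i S hi ih =>
      have hcont : Continuous fun m : Fin n → E => (S.piecewise m b, m i - b i) := by
        refine .prodMk (continuous_pi fun j => ?_) (by fun_prop)
        by_cases hj : j ∈ S
        · simpa [hj] using continuous_apply j
        · simpa [hj] using continuous_const
      have h1 := hcont.tendsto b
      simp only [sub_self] at h1
      have h2 := ih.add ((small i _).comp h1)
      rw [add_zero] at h2
      refine h2.congr fun m => ?_
      rw [Finset.piecewise_insert]
      have e2 := Ψ.map_update_add (S.piecewise m b) i (b i) (m i - b i)
      have e3 : Function.update (S.piecewise m b) i (b i) = S.piecewise m b := by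
        simp [hi]
      rw [e3, add_sub_cancel] at e2
      exact e2.symm
  simpa [ContinuousAt] using key Finset.univ

theorem multilinear_bounded_of_isVonNBounded (hΨ : Continuous Ψ) {B : Set (Fin n → E)}
    (hB : Bornology.IsVonNBounded ℝ B) : BddAbove ((fun ξ => ‖Ψ ξ‖) '' B) := by
  -- For `n = 0` the map is a constant that need not vanish at the zero tuple, so the absorption
  -- argument requires `n > 0`.
  rcases Nat.eq_zero_or_pos n with rfl | hn
  · refine ⟨‖Ψ 0‖, ?_⟩
    rintro _ ⟨ξ, -, rfl⟩
    rw [Subsingleton.elim ξ 0]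
  have h0 : {m | ‖Ψ m‖ < 1} ∈ 𝓝 (0 : Fin n → E) := by
    refine (isOpen_lt hΨ.norm continuous_const).mem_nhds ?_
    have : Nonempty (Fin n) := ⟨⟨0, hn⟩⟩
    simp [Ψ.map_zero]
  obtain ⟨r, hr⟩ := (hB h0).exists
  refine ⟨|r| ^ n, ?_⟩
  rintro _ ⟨ξ, hξ, rfl⟩
  obtain ⟨m, hm, rfl⟩ := hr hξ
  have h3 : Ψ (r • m) = r ^ n • Ψ m := multilinear_map_smul Ψ r m
  simp only [h3, norm_smul, norm_pow, Real.norm_eq_abs]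
  exact mul_le_of_le_one_right (by positivity) (le_of_lt hm)

end LocallyBounded

/-! ### Continuity from weak continuity, by Baire -/

theorem norm_le_of_dense_inner {H : Type*} [NormedAddCommGroup H] [InnerProductSpace ℂ H]
    {S : Set H} (hS : Dense S) {a : H} {k : ℝ} (hk : 0 ≤ k)
    (h : ∀ φ ∈ S, ‖(inner ℂ φ a : ℂ)‖ ≤ ‖φ‖ * k) : ‖a‖ ≤ k := by
  have hc : IsClosed {φ : H | ‖(inner ℂ φ a : ℂ)‖ ≤ ‖φ‖ * k} :=
    isClosed_le (by fun_prop) (by fun_prop)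
  have h1 : ‖(inner ℂ a a : ℂ)‖ ≤ ‖a‖ * k := hc.closure_subset_iff.2 h (hS a)
  rw [inner_self_eq_norm_sq_to_K, norm_pow] at h1
  simp only [Complex.coe_algebraMap, Complex.norm_real, norm_norm, sq] at h1
  rcases (norm_nonneg a).eq_or_lt with h2 | h2
  · rwa [← h2]
  · exact le_of_mul_le_mul_left h1 h2

/-- A multilinear map from a Fréchet space to a Hilbert space is continuous if it is continuous
when tested against a dense set of vectors. -/
theorem multilinear_continuous_of_weak {E : Type*} [AddCommGroup E] [Module ℝ E] [UniformSpace E]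
    [IsUniformAddGroup E] [ContinuousSMul ℝ E] [CompleteSpace E] [IsCountablyGenerated (𝓤 E)]
    {H : Type*} [NormedAddCommGroup H] [InnerProductSpace ℂ H] {n : ℕ}
    (Ψ : MultilinearMap ℝ (fun _ : Fin n => E) H) {S : Set H} (hS : Dense S)
    (h : ∀ φ ∈ S, Continuous fun ξ => inner ℂ φ (Ψ ξ)) : Continuous Ψ := by
  -- The norm bound is equivalent to bounds on the pairings with `S`, each a closed condition; thus
  -- Baire's theorem applies to these sets.
  have hcl : ∀ k : ℕ, IsClosed {ξ | ‖Ψ ξ‖ ≤ k} := by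
    intro k
    have : {ξ | ‖Ψ ξ‖ ≤ k} = ⋂ φ ∈ S, {ξ | ‖(inner ℂ φ (Ψ ξ) : ℂ)‖ ≤ ‖φ‖ * k} := by
      ext ξ
      simp only [mem_ofPred_eq, mem_iInter]
      refine ⟨fun hξ φ _ => (norm_inner_le_norm _ _).trans
        (mul_le_mul_of_nonneg_left hξ (norm_nonneg _)), fun hξ => ?_⟩
      exact norm_le_of_dense_inner hS (Nat.cast_nonneg k) hξ
    rw [this]
    exact isClosed_biInter fun φ hφ => isClosed_le (h φ hφ).norm continuous_const
  have hun : ⋃ k : ℕ, {ξ | ‖Ψ ξ‖ ≤ k} = univ :=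
    eq_univ_of_forall fun ξ => mem_iUnion.2 (exists_nat_ge ‖Ψ ξ‖)
  obtain ⟨k, a, ha⟩ := nonempty_interior_of_iUnion_of_closed hcl hun
  obtain ⟨C, hC⟩ := multilinear_bounded_near_zero Ψ (mem_interior_iff_mem_nhds.1 ha)
  exact multilinear_continuous_of_locally_bounded Ψ (multilinear_locally_bounded Ψ hC)

theorem ckOn_clm_add_const {E : Type u} [AddCommGroup E] [Module ℝ E] [TopologicalSpace E]
    [IsTopologicalAddGroup E] [ContinuousSMul ℝ E] {F : Type w} [AddCommGroup F] [Module ℝ F]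
    [TopologicalSpace F] [T2Space F] [IsTopologicalAddGroup F] (n : ℕ) (L : E →L[ℝ] F) (c : F)
    {U : Set E} (hU : IsOpen U) : CkOn n (fun x => L x + c) U := by
  have hc : Continuous fun x => L x + c := by fun_prop
  cases n with
  | zero => exact hc.continuousOn
  | succ n =>
    refine .of_hasDirDerivAt (f' := L.comp (ContinuousLinearMap.snd ℝ E E)) hU hc.continuousOn
      (fun x _ v => (hasDirDerivAt_clm L x v).congr fun t => ?_)
      (ckOn_clm _ _ _ (hU.prod isOpen_univ))
    simp

/-! ### Left division and the left logarithmic derivative in charts -/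

section LieGroup

variable {E : Type u} [AddCommGroup E] [Module ℝ E] [TopologicalSpace E]
  [IsTopologicalAddGroup E] [ContinuousSMul ℝ E] [LocallyConvexSpace ℝ E] [T2Space E]
  {G : Type v} [Group G] [TopologicalSpace G] [ChartedSpace E G]

/-- The domain of the multiplication in the charts `e₁`, `e₂`, `e`. -/
def mulDomain (e₁ e₂ e : OpenPartialHomeomorph G E) : Set (E × E) :=
  (e₁.target ×ˢ e₂.target) ∩ {p | e₁.symm p.1 * e₂.symm p.2 ∈ e.source}

theorem IsLieGroup.isOpen_mulDomain (hG : IsLieGroup E G) (e₁ e₂ e : OpenPartialHomeomorph G E) :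
    IsOpen (mulDomain e₁ e₂ e) := by
  have hc : ContinuousOn (fun p : E × E => e₁.symm p.1 * e₂.symm p.2)
      (e₁.target ×ˢ e₂.target) :=
    hG.continuous_mul.comp_continuousOn
      ((e₁.continuousOn_symm.comp continuousOn_fst fun p hp => hp.1).prodMk
        (e₂.continuousOn_symm.comp continuousOn_snd fun p hp => hp.2))
  exact hc.isOpen_inter_preimage (e₁.open_target.prod e₂.open_target) e.open_source

theorem IsLieGroup.ckOn_mul (hG : IsLieGroup E G) {e₁ e₂ e : OpenPartialHomeomorph G E}
    (h₁ : e₁ ∈ atlas E G) (h₂ : e₂ ∈ atlas E G) (h : e ∈ atlas E G) (n : ℕ) :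
    CkOn n (fun p : E × E => e (e₁.symm p.1 * e₂.symm p.2)) (mulDomain e₁ e₂ e) :=
  (hG.smooth_mul e₁ h₁ e₂ h₂ e h).ckOn (hG.isOpen_mulDomain e₁ e₂ e) n

/-- The domain of the inversion in the charts `e`, `e'`. -/
def invDomain (e e' : OpenPartialHomeomorph G E) : Set E :=
  e.target ∩ {x | (e.symm x)⁻¹ ∈ e'.source}

theorem IsLieGroup.isOpen_invDomain (hG : IsLieGroup E G) (e e' : OpenPartialHomeomorph G E) :
    IsOpen (invDomain e e') :=
  (hG.smooth_inv.1.comp_continuousOn e.continuousOn_symm).isOpen_inter_preimage e.open_target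
    e'.open_source

theorem IsLieGroup.ckOn_inv (hG : IsLieGroup E G) {e e' : OpenPartialHomeomorph G E}
    (h : e ∈ atlas E G) (h' : e' ∈ atlas E G) (n : ℕ) :
    CkOn n (fun x => e' (e.symm x)⁻¹) (invDomain e e') :=
  (hG.smooth_inv.2 e h e' h').ckOn (hG.isOpen_invDomain e e') n

/-- The domain of the left division `(g, h) ↦ g⁻¹ h` in the chart `e` and the preferred chart
at `1`. -/
def leftDivDomain (e : OpenPartialHomeomorph G E) : Set (E × E) :=
  (e.target ×ˢ e.target) ∩ {p | (e.symm p.1)⁻¹ * e.symm p.2 ∈ (chartAt E (1 : G)).source}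

/-- The left division `(g, h) ↦ g⁻¹ h` in the chart `e` and the preferred chart at `1`. -/
def leftDiv (e : OpenPartialHomeomorph G E) (p : E × E) : E :=
  chartAt E (1 : G) ((e.symm p.1)⁻¹ * e.symm p.2)

theorem IsLieGroup.isOpen_leftDivDomain (hG : IsLieGroup E G) (e : OpenPartialHomeomorph G E) :
    IsOpen (leftDivDomain e) := by
  have hc : ContinuousOn (fun p : E × E => (e.symm p.1)⁻¹ * e.symm p.2)
      (e.target ×ˢ e.target) :=
    hG.continuous_mul.comp_continuousOn
      ((hG.smooth_inv.1.comp_continuousOn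
          (e.continuousOn_symm.comp continuousOn_fst fun p hp => hp.1)).prodMk
        (e.continuousOn_symm.comp continuousOn_snd fun p hp => hp.2))
  exact hc.isOpen_inter_preimage (e.open_target.prod e.open_target) (chartAt E (1 : G)).open_source

/-- Inverses need not lie in one chart, so the argument is local: near `p`, inversion is read in a
chart at the inverse of `e.symm p.1` and followed by the multiplication. -/
theorem IsLieGroup.ckOn_leftDiv (hG : IsLieGroup E G) {e : OpenPartialHomeomorph G E}
    (h : e ∈ atlas E G) (n : ℕ) : CkOn n (leftDiv e) (leftDivDomain e) := by
  refine .of_locally fun p hp => ?_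
  set e' := chartAt E ((e.symm p.1)⁻¹ : G)
  have he' : e' ∈ atlas E G := chart_mem_atlas E _
  have hV : IsOpen (leftDivDomain e ∩ Prod.fst ⁻¹' (invDomain e e')) :=
    (hG.isOpen_leftDivDomain e).inter ((hG.isOpen_invDomain e e').preimage continuous_fst)
  refine ⟨_, hV, ⟨hp, hp.1.1, mem_chart_source E _⟩, ?_⟩
  have h1 : CkOn n (fun q : E × E => (e' (e.symm q.1)⁻¹, q.2))
      (leftDivDomain e ∩ Prod.fst ⁻¹' (invDomain e e')) := by
    refine CkOn.prodMk hV (CkOn.mono ?_ inter_subset_right)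
      (ckOn_clm n (ContinuousLinearMap.snd ℝ E E) _ hV)
    exact (hG.ckOn_inv h he' n).comp_clm (hG.isOpen_invDomain e e')
      (ContinuousLinearMap.fst ℝ E E)
  refine ((hG.ckOn_mul he' h (chart_mem_atlas E (1 : G)) n).comp hV
    (hG.isOpen_mulDomain _ _ _) h1 ?_).congr hV ?_
  · rintro q ⟨hq, hq'⟩
    refine ⟨⟨e'.map_source hq'.2, hq.1.2⟩, ?_⟩
    have := hq.2
    simpa only [mem_ofPred_eq, e'.left_inv hq'.2] using this
  · rintro q ⟨hq, hq'⟩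
    simp only [e'.left_inv hq'.2, leftDiv]

/-- The left logarithmic derivative of the parametrization `e.symm` of `G`. -/
noncomputable def leftLogDeriv (e : OpenPartialHomeomorph G E) (p : E × E) : E :=
  dirDeriv (leftDiv e) ((p.1, p.1), (0, p.2))

theorem diag_mem_leftDivDomain {e : OpenPartialHomeomorph G E} {x : E} (hx : x ∈ e.target) :
    (x, x) ∈ leftDivDomain e :=
  ⟨⟨hx, hx⟩, by simp⟩

theorem IsLieGroup.ckOn_leftLogDeriv (hG : IsLieGroup E G) {e : OpenPartialHomeomorph G E}
    (h : e ∈ atlas E G) (n : ℕ) : CkOn n (leftLogDeriv e) (e.target ×ˢ univ) := by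
  let L : E × E →L[ℝ] (E × E) × (E × E) :=
    ((ContinuousLinearMap.fst ℝ E E).prod (ContinuousLinearMap.fst ℝ E E)).prod
      ((0 : E × E →L[ℝ] E).prod (ContinuousLinearMap.snd ℝ E E))
  exact ((hG.ckOn_leftDiv h (n + 1)).2.2.comp_clm ((hG.isOpen_leftDivDomain e).prod isOpen_univ)
    L).mono fun p hp => ⟨diag_mem_leftDivDomain hp.1, trivial⟩

theorem IsLieGroup.hasVelocityAtOne_leftDiv (hG : IsLieGroup E G) {e : OpenPartialHomeomorph G E}
    (h : e ∈ atlas E G) {x : E} (hx : x ∈ e.target) (v : E) :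
    HasVelocityAtOne E (fun t : ℝ => (e.symm x)⁻¹ * e.symm (x + t • v)) (leftLogDeriv e (x, v)) := by
  refine ⟨?_, by simp, ?_⟩
  · have h1 : ContinuousAt (fun t : ℝ => x + t • v) 0 := Continuous.continuousAt (by fun_prop)
    have h2 : ContinuousAt e.symm (x + (0 : ℝ) • v) := by
      simpa using e.continuousAt_symm hx
    exact hG.continuous_mul.continuousAt.comp (continuousAt_const.prodMk
      (h2.comp (f := fun t : ℝ => x + t • v) h1))
  · have h1 := (hG.ckOn_leftDiv h 1).2.1 _ (diag_mem_leftDivDomain hx) (0, v)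
    simpa [HasDirDerivAt, leftDiv, leftLogDeriv] using h1

end LieGroup

/-! ### Smooth vectors and derivatives of orbit maps -/

section Representation

variable {E : Type u} [AddCommGroup E] [Module ℝ E] [TopologicalSpace E]
  [IsTopologicalAddGroup E] [ContinuousSMul ℝ E] [LocallyConvexSpace ℝ E] [T2Space E]
  {G : Type v} [Group G] [TopologicalSpace G] [ChartedSpace E G]
  {H : Type w} [NormedAddCommGroup H] [InnerProductSpace ℂ H] [CompleteSpace H]
  (ρ : G →* unitary (H →L[ℂ] H))

theorem rep_mul (g h : G) (ψ : H) :
    (ρ (g * h) : H →L[ℂ] H) ψ = (ρ g : H →L[ℂ] H) ((ρ h : H →L[ℂ] H) ψ) := by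
  simp

theorem rep_one (ψ : H) : (ρ 1 : H →L[ℂ] H) ψ = ψ := by simp

theorem rep_inner (g : G) (ψ φ : H) :
    inner ℂ ((ρ g : H →L[ℂ] H) ψ) ((ρ g : H →L[ℂ] H) φ) = inner ℂ ψ φ :=
  ContinuousLinearMap.inner_map_map_of_mem_unitary (ρ g).2 ψ φ

theorem rep_norm (g : G) (ψ : H) : ‖(ρ g : H →L[ℂ] H) ψ‖ = ‖ψ‖ :=
  ContinuousLinearMap.norm_map_of_mem_unitary (ρ g).2 ψ

theorem rep_inv_inner (g : G) (ψ φ : H) :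
    inner ℂ ((ρ g⁻¹ : H →L[ℂ] H) ψ) φ = inner ℂ ψ ((ρ g : H →L[ℂ] H) φ) := by
  rw [← rep_inner ρ g, ← rep_mul, mul_inv_cancel, rep_one]

theorem mem_smoothVectors_iff {ψ : H} : ψ ∈ smoothVectors E ρ ↔
    ∀ e ∈ atlas E G, ∀ n, CkOn n (fun x => (ρ (e.symm x) : H →L[ℂ] H) ψ) e.target := by
  constructor
  · intro h e he n
    have h1 := h.2 e he (OpenPartialHomeomorph.refl H) (by simp)
    simp only [OpenPartialHomeomorph.refl_apply, OpenPartialHomeomorph.refl_source, mem_univ,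
      ofPred_true, inter_univ] at h1
    exact h1.ckOn e.open_target n
  · intro h
    refine ⟨continuous_iff_continuousAt.2 fun g => ?_, fun e he e' he' => ?_⟩
    · have h1 := (h _ (chart_mem_atlas E g) 0).continuousOn.continuousAt
        ((chartAt E g).open_target.mem_nhds (mem_chart_target E g))
      have h2 := ContinuousAt.comp h1 ((chartAt E g).continuousAt (mem_chart_source E g))
      refine h2.congr ?_
      filter_upwards [(chartAt E g).open_source.mem_nhds (mem_chart_source E g)] with g' hg'
      simp [(chartAt E g).left_inv hg']
    · obtain rfl : e' = OpenPartialHomeomorph.refl H := by simpa using he'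
      simpa using smoothOn_of_forall_ckOn e.open_target (h e he)

/-- The derivative of the orbit map of `ψ` at `1` in the direction `ξ`. -/
noncomputable def derivedVector (E : Type u) [AddCommGroup E] [Module ℝ E] [TopologicalSpace E]
    [ChartedSpace E G] (ψ : H) (ξ : E) : H :=
  dirDeriv (fun y => (ρ ((chartAt E (1 : G)).symm y) : H →L[ℂ] H) ψ) (chartAt E (1 : G) 1, ξ)

variable {ρ}

theorem hasDirDerivAt_orbit {ψ : H} (hψ : ψ ∈ smoothVectors E ρ) (ξ : E) :
    HasDirDerivAt (fun y => (ρ ((chartAt E (1 : G)).symm y) : H →L[ℂ] H) ψ)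
      (derivedVector ρ E ψ ξ) (chartAt E (1 : G) 1) ξ :=
  ((mem_smoothVectors_iff ρ).1 hψ _ (chart_mem_atlas E 1) 1).2.1 _ (mem_chart_target E 1) ξ

/-- In the chart the curve is `c 1 + t • k t` with `k t` tending to `ξ`, which is the case of a
varying direction. -/
theorem tendsto_rep_curve {ψ : H} (hψ : ψ ∈ smoothVectors E ρ) {γ : ℝ → G} {ξ : E}
    (hγ : HasVelocityAtOne E γ ξ) :
    Tendsto (fun t : ℝ => t⁻¹ • ((ρ (γ t) : H →L[ℂ] H) ψ - ψ)) (𝓝[≠] 0)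
      (𝓝 (derivedVector ρ E ψ ξ)) := by
  set c := chartAt E (1 : G)
  have h1 := ((mem_smoothVectors_iff ρ).1 hψ _ (chart_mem_atlas E 1) 1).hasDirDerivAt_of_tendsto
    c.open_target (mem_chart_target E 1) hγ.2.2
  refine h1.congr' ?_
  have hs : c.source ∈ 𝓝 (γ 0) := by
    rw [hγ.2.1]; exact c.open_source.mem_nhds (mem_chart_source E 1)
  filter_upwards [nhdsWithin_le_nhds (hγ.1 hs), self_mem_nhdsWithin] with t ht ht0
  rw [smul_inv_smul₀ ht0, add_sub_cancel, c.left_inv ht, c.left_inv (mem_chart_source E 1), rep_one]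

theorem hasDerivAt_rep_curve {ψ : H} (hψ : ψ ∈ smoothVectors E ρ) {γ : ℝ → G} {ξ : E}
    (hγ : HasVelocityAtOne E γ ξ) :
    HasDerivAt (fun t => (ρ (γ t) : H →L[ℂ] H) ψ) (derivedVector ρ E ψ ξ) 0 := by
  rw [hasDerivAt_iff_tendsto_slope_zero]
  simpa [hγ.2.1] using tendsto_rep_curve hψ hγ

/-- Every tangent vector at `1` is the velocity of a curve, a straight line in the chart. -/
theorem exists_hasVelocityAtOne (G : Type v) [Group G] [TopologicalSpace G] [ChartedSpace E G]
    (ξ : E) : ∃ γ : ℝ → G, HasVelocityAtOne E γ ξ := by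
  set c := chartAt E (1 : G) with hc
  refine ⟨fun t => c.symm (c 1 + t • ξ), ?_, by simp [hc], ?_⟩
  · have h1 : ContinuousAt (fun t : ℝ => c 1 + t • ξ) 0 := Continuous.continuousAt (by fun_prop)
    have h2 : ContinuousAt c.symm (c 1 + (0 : ℝ) • ξ) := by
      simpa using c.continuousAt_symm (mem_chart_target E 1)
    exact h2.comp (f := fun t : ℝ => c 1 + t • ξ) h1
  · refine Tendsto.congr' ?_ tendsto_const_nhds
    filter_upwards [(tendsto_line (c 1) ξ).eventually
      (c.open_target.mem_nhds (mem_chart_target E 1)), self_mem_nhdsWithin] with t ht ht0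
    rw [c.right_inv ht, add_sub_cancel_left, inv_smul_smul₀ ht0]

/-- The vector is the derivative of `ρ (g * h) (A z)` in `h` at `h = 1`, and smoothness of the
multiplication makes that map jointly smooth in `g`, `h`, `z`. The parameter space `Y` carries the
entries already used, so that the lemma can be iterated. -/
theorem ckOn_derivedVector (hG : IsLieGroup E G) {Y : Type*} [AddCommGroup Y] [Module ℝ Y]
    [TopologicalSpace Y] [IsTopologicalAddGroup Y] [ContinuousSMul ℝ Y] [T2Space Y] {A : Y → H}
    (hA : ∀ e ∈ atlas E G, ∀ n, CkOn n (fun p : E × Y => (ρ (e.symm p.1) : H →L[ℂ] H) (A p.2))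
      (e.target ×ˢ univ)) (e : OpenPartialHomeomorph G E) (he : e ∈ atlas E G) (n : ℕ) :
    CkOn n (fun p : E × (E × Y) =>
      (ρ (e.symm p.1) : H →L[ℂ] H) (derivedVector ρ E (A p.2.2) p.2.1)) (e.target ×ˢ univ) := by
  set c := chartAt E (1 : G) with hc
  have hcat : c ∈ atlas E G := chart_mem_atlas E 1
  have hAs : ∀ z, A z ∈ smoothVectors E ρ := by
    intro z
    rw [mem_smoothVectors_iff]
    intro e he n
    have h1 := (hA e he n).comp e.open_target (e.open_target.prod isOpen_univ)
      (ckOn_clm_add_const n (ContinuousLinearMap.inl ℝ E Y) (0, z) e.open_target)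
      (fun x hx => ⟨by simpa using hx, trivial⟩)
    simpa using h1
  let pr : E × (E × Y) →L[ℝ] E × E := (ContinuousLinearMap.fst ℝ E (E × Y)).prod
    ((ContinuousLinearMap.fst ℝ E Y).comp (ContinuousLinearMap.snd ℝ E (E × Y)))
  let pz : E × (E × Y) →L[ℝ] Y :=
    (ContinuousLinearMap.snd ℝ E Y).comp (ContinuousLinearMap.snd ℝ E (E × Y))
  set Ω : Set (E × (E × Y)) := pr ⁻¹' (mulDomain e c e) with hΩ
  have hΩo : IsOpen Ω := (hG.isOpen_mulDomain e c e).preimage pr.continuous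
  let Q : E × (E × Y) → H := fun p =>
    (ρ (e.symm p.1 * c.symm p.2.1) : H →L[ℂ] H) (A p.2.2)
  have hQ : CkOn (n + 1) Q Ω := by
    refine ((hA e he (n + 1)).comp hΩo (e.open_target.prod isOpen_univ)
      (g := fun p => (e (e.symm p.1 * c.symm p.2.1), p.2.2)) ?_ ?_).congr hΩo ?_
    · exact CkOn.prodMk hΩo ((hG.ckOn_mul he hcat he (n + 1)).comp_clm
        (hG.isOpen_mulDomain e c e) pr) (ckOn_clm _ pz _ hΩo)
    · exact fun p hp => ⟨e.map_source hp.2, trivial⟩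
    · intro p hp
      have := e.left_inv hp.2
      simp only [Q]
      rw [show e.symm (e (e.symm p.1 * c.symm p.2.1)) = e.symm p.1 * c.symm p.2.1 from this]
  -- With the constant added below, `L` sets the second group variable to `1` and differentiates in
  -- it alone.
  let L : E × (E × Y) →L[ℝ] (E × (E × Y)) × (E × (E × Y)) :=
    ((ContinuousLinearMap.fst ℝ E (E × Y)).prod
      ((0 : E × (E × Y) →L[ℝ] E).prod pz)).prod
    ((0 : E × (E × Y) →L[ℝ] E).prod
      (((ContinuousLinearMap.fst ℝ E Y).comp (ContinuousLinearMap.snd ℝ E (E × Y))).prod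
        (0 : E × (E × Y) →L[ℝ] Y)))
  have hmem : ∀ p : E × (E × Y), p.1 ∈ e.target → (p.1, (c 1, p.2.2)) ∈ Ω := by
    intro p hp
    refine ⟨⟨hp, mem_chart_target E 1⟩, ?_⟩
    change e.symm p.1 * c.symm (c 1) ∈ e.source
    rw [c.left_inv (mem_chart_source E 1), mul_one]
    exact e.map_target hp
  have hU : IsOpen (e.target ×ˢ (univ : Set (E × Y))) := e.open_target.prod isOpen_univ
  refine (hQ.2.2.comp hU (hΩo.prod isOpen_univ)
    (ckOn_clm_add_const n L ((0, (c 1, 0)), 0) hU) ?_).congr hU ?_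
  · intro p hp
    refine ⟨?_, trivial⟩
    simpa [L, pz] using hmem p hp.1
  · rintro ⟨x, η, z⟩ ⟨hx, -⟩
    have h1 : L (x, η, z) + ((0, (c 1, 0)), 0) = ((x, (c 1, z)), (0, (η, 0))) := by
      simp [L, pz]
    simp only [h1]
    refine HasDirDerivAt.dirDeriv_eq ?_
    have h2 := hasDirDerivAt_orbit (hAs z) η
    refine (((ρ (e.symm x) : H →L[ℂ] H).continuous.tendsto _).comp h2).congr fun t => ?_
    simp only [Function.comp, Q, rep_mul, ContinuousLinearMap.map_smul_of_tower, map_sub]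
    simp [hc]

theorem derivedVector_mem (hG : IsLieGroup E G) {ψ : H} (hψ : ψ ∈ smoothVectors E ρ) (ξ : E) :
    derivedVector ρ E ψ ξ ∈ smoothVectors E ρ := by
  rw [mem_smoothVectors_iff] at hψ ⊢
  intro e he n
  have h1 := ckOn_derivedVector hG (Y := Fin 0 → E) (A := fun _ => ψ) (fun e he n =>
    ((hψ e he n).comp_clm e.open_target (ContinuousLinearMap.fst ℝ E (Fin 0 → E))).mono
      fun p hp => hp.1) e he n
  have h2 := h1.comp e.open_target (e.open_target.prod isOpen_univ)
      (ckOn_clm_add_const n (ContinuousLinearMap.inl ℝ E (E × (Fin 0 → E))) (0, (ξ, 0))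
        e.open_target)
      (fun x hx => ⟨by simpa using hx, trivial⟩)
  simpa using h2

/-- The orbit map of `ρ g ψ` is that of `ψ` after right translation by `g`, which is smooth in
charts. -/
theorem rep_mem_smoothVectors (hG : IsLieGroup E G) {ψ : H} (hψ : ψ ∈ smoothVectors E ρ) (g : G) :
    (ρ g : H →L[ℂ] H) ψ ∈ smoothVectors E ρ := by
  rw [mem_smoothVectors_iff] at hψ ⊢
  intro e he n
  refine .of_locally fun x hx => ?_
  set e₀ := chartAt E g
  set e' := chartAt E (e.symm x * g)
  let L : E → E × E := fun x => ContinuousLinearMap.inl ℝ E E x + (0, e₀ g)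
  have hL : ∀ x, L x = (x, e₀ g) := fun x => by simp [L]
  have hLc : Continuous L := by fun_prop
  have hV : IsOpen (L ⁻¹' mulDomain e e₀ e') := (hG.isOpen_mulDomain e e₀ e').preimage hLc
  have hg : e₀.symm (e₀ g) = g := e₀.left_inv (mem_chart_source E g)
  refine ⟨_, hV, ?_, ?_⟩
  · rw [mem_preimage, hL]
    refine ⟨⟨hx, mem_chart_target E g⟩, ?_⟩
    simp only [mem_ofPred_eq, hg]
    exact mem_chart_source E _
  · refine ((hψ e' (chart_mem_atlas E _) n).comp hV e'.open_target
      ((hG.ckOn_mul he (chart_mem_atlas E g) (chart_mem_atlas E _) n).comp hV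
        (hG.isOpen_mulDomain e e₀ e') (ckOn_clm_add_const n _ _ hV) fun _ h => h) ?_).congr hV ?_
    · exact fun y hy => e'.map_source hy.2
    · intro y hy
      have h1 := hy.2
      simp only [hL, mem_ofPred_eq, hg] at h1
      change (ρ (e'.symm (e' (e.symm (L y).1 * e₀.symm (L y).2))) : H →L[ℂ] H) ψ = _
      simp only [hL, hg]
      rw [e'.left_inv h1, rep_mul]

end Representation

/-! ### The derived representation; from weak to strong derivatives -/

section DerivedRep

variable {E : Type u} [AddCommGroup E] [Module ℝ E] [TopologicalSpace E]
  [IsTopologicalAddGroup E] [ContinuousSMul ℝ E] [LocallyConvexSpace ℝ E] [T2Space E]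
  {G : Type v} [Group G] [TopologicalSpace G] [ChartedSpace E G]
  {H : Type w} [NormedAddCommGroup H] [InnerProductSpace ℂ H] [CompleteSpace H]

/-- The derived representation, as a linear map. -/
noncomputable def derivedRep (hG : IsLieGroup E G) (ρ : G →* unitary (H →L[ℂ] H)) :
    E →ₗ[ℝ] Module.End ℂ (smoothVectors E ρ) where
  toFun ξ :=
    { toFun := fun ψ => ⟨derivedVector ρ E (ψ : H) ξ, derivedVector_mem hG ψ.2 ξ⟩
      map_add' := fun ψ φ => by
        refine Subtype.ext ((hasDirDerivAt_orbit (ψ + φ).2 ξ).unique ?_)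
        refine ((hasDirDerivAt_orbit ψ.2 ξ).add (hasDirDerivAt_orbit φ.2 ξ)).congr fun t => ?_
        rw [← smul_add]
        simp only [Submodule.coe_add, map_add, add_sub_add_comm]
      map_smul' := fun c ψ => by
        refine Subtype.ext ((hasDirDerivAt_orbit (c • ψ).2 ξ).unique ?_)
        refine (Tendsto.const_smul (hasDirDerivAt_orbit ψ.2 ξ) c).congr fun t => ?_
        rw [smul_comm]
        simp only [Submodule.coe_smul, map_smul, smul_sub] }
  map_add' ξ η := by
    refine LinearMap.ext fun ψ => Subtype.ext ?_
    exact ((mem_smoothVectors_iff ρ).1 ψ.2 _ (chart_mem_atlas E 1) 1).dirDeriv_add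
      (chartAt E (1 : G)).open_target (mem_chart_target E 1) ξ η
  map_smul' c ξ := by
    refine LinearMap.ext fun ψ => Subtype.ext ?_
    exact ((mem_smoothVectors_iff ρ).1 ψ.2 _ (chart_mem_atlas E 1) 1).dirDeriv_smul
      (mem_chart_target E 1) c ξ

variable (hG : IsLieGroup E G) (ρ : G →* unitary (H →L[ℂ] H))

theorem coe_derivedRep (ξ : E) (ψ : smoothVectors E ρ) :
    (derivedRep hG ρ ξ ψ : H) = derivedVector ρ E (ψ : H) ξ := rfl

theorem isDerivedRep_derivedRep : IsDerivedRep E ρ (derivedRep hG ρ) :=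
  fun _ ψ _ hγ => hasDerivAt_rep_curve ψ.2 hγ

/-- Differentiate the constant function `⟨ρ(γ t) ψ, ρ(γ t) φ⟩` at `t = 0`. -/
theorem inner_derivedRep_left (ξ : E) (ψ φ : smoothVectors E ρ) :
    inner ℂ (derivedRep hG ρ ξ ψ : H) (φ : H) = - inner ℂ (ψ : H) (derivedRep hG ρ ξ φ : H) := by
  obtain ⟨γ, hγ⟩ := exists_hasVelocityAtOne G ξ
  have h1 := (hasDerivAt_rep_curve ψ.2 hγ).inner ℂ (hasDerivAt_rep_curve φ.2 hγ)
  simp only [rep_inner, hγ.2.1, rep_one] at h1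
  exact eq_neg_of_add_eq_zero_right (h1.unique (hasDerivAt_const _ _))

/-- The map `(ξ₁, …, ξₙ) ↦ dρ(ξ₁) ⋯ dρ(ξₙ) ψ` into the Hilbert space. -/
noncomputable def iterMultilinear (n : ℕ) (ψ : smoothVectors E ρ) :
    MultilinearMap ℝ (fun _ : Fin n => E) H :=
  (((smoothVectors E ρ).subtype.restrictScalars ℝ).comp
    ((LinearMap.applyₗ' ℂ ψ : Module.End ℂ (smoothVectors E ρ) →ₗ[ℂ] _).restrictScalars ℝ)).compMultilinearMap
    ((MultilinearMap.mkPiAlgebraFin ℝ n (Module.End ℂ (smoothVectors E ρ))).compLinearMap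
      fun _ => derivedRep hG ρ)

theorem iterMultilinear_apply (n : ℕ) (ψ : smoothVectors E ρ) (ξ : Fin n → E) :
    iterMultilinear hG ρ n ψ ξ = (iter (derivedRep hG ρ) ξ ψ : H) := by
  simp [iterMultilinear, iter]

theorem iter_succ {𝔤 V : Type*} [NormedAddCommGroup V] [NormedSpace ℂ V]
    (π : 𝔤 → Module.End ℂ V) {n : ℕ} (ξ : Fin (n + 1) → 𝔤) (ψ : V) :
    iter π ξ ψ = π (ξ 0) (iter π (Fin.tail ξ) ψ) := by
  simp [iter, List.ofFn_succ, Fin.tail]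

theorem iter_zero {𝔤 V : Type*} [NormedAddCommGroup V] [NormedSpace ℂ V]
    (π : 𝔤 → Module.End ℂ V) (ξ : Fin 0 → 𝔤) (ψ : V) : iter π ξ ψ = ψ := by
  simp [iter]

/-- The map splitting off the first entry of a tuple. -/
def splitFirst (E : Type u) [AddCommGroup E] [Module ℝ E] [TopologicalSpace E] (n : ℕ) :
    E × (Fin (n + 1) → E) →L[ℝ] E × (E × (Fin n → E)) where
  toFun p := (p.1, (p.2 0, Fin.tail p.2))
  map_add' _ _ := rfl
  map_smul' _ _ := rfl
  cont := by
    refine .prodMk (by fun_prop) (.prodMk (by fun_prop) (continuous_pi fun i => ?_))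
    exact (continuous_apply i.succ).comp continuous_snd

theorem ckOn_iter (ψ : smoothVectors E ρ) (n : ℕ) : ∀ e ∈ atlas E G, ∀ k,
    CkOn k (fun p : E × (Fin n → E) =>
      (ρ (e.symm p.1) : H →L[ℂ] H) (iter (derivedRep hG ρ) p.2 ψ : H)) (e.target ×ˢ univ) := by
  induction n with
  | zero =>
    intro e he k
    simp only [iter_zero]
    exact (((mem_smoothVectors_iff ρ).1 ψ.2 e he k).comp_clm e.open_target
      (ContinuousLinearMap.fst ℝ E (Fin 0 → E))).mono fun p hp => hp.1
  | succ n ih =>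
    intro e he k
    simp only [iter_succ, coe_derivedRep]
    have h1 := ckOn_derivedVector hG
      (A := fun ζ : Fin n → E => (iter (derivedRep hG ρ) ζ ψ : H)) ih e he k
    have h2 := h1.comp_clm (e.open_target.prod isOpen_univ) (splitFirst E n)
    refine (h2.mono fun p hp => ⟨hp.1, trivial⟩).congr (e.open_target.prod isOpen_univ) ?_
    exact fun p _ => rfl

theorem continuous_iterMultilinear (n : ℕ) (ψ : smoothVectors E ρ) :
    Continuous (iterMultilinear hG ρ n ψ) := by
  have h1 := (ckOn_iter hG ρ ψ n _ (chart_mem_atlas E 1) 0).continuousOn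
  have h2 := h1.comp_continuous (f := fun ξ : Fin n → E => (chartAt E (1 : G) 1, ξ))
    (by fun_prop) fun ξ => ⟨mem_chart_target E 1, trivial⟩
  refine h2.congr fun ξ => ?_
  simp only [Function.comp, (chartAt E (1 : G)).left_inv (mem_chart_source E 1), rep_one,
    iterMultilinear_apply]

theorem strongSeminormsFinite_derivedRep : StrongSeminormsFinite (derivedRep hG ρ) := by
  intro n B hB ψ
  have := multilinear_bounded_of_isVonNBounded _ (continuous_iterMultilinear hG ρ n ψ) hB
  simpa only [iterMultilinear_apply, Submodule.coe_norm] using this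

variable {ρ} (hρ : IsSmoothRep E ρ)
include hρ

/-- Since each `ρ g` is isometric, approximating `χ` by smooth vectors approximates its orbit map
uniformly on `G`. -/
theorem IsSmoothRep.continuous_orbit (χ : H) : Continuous fun g => (ρ g : H →L[ℂ] H) χ := by
  refine continuous_of_uniform_approx_of_continuous fun u hu => ?_
  obtain ⟨ε, hε, hu⟩ := Metric.mem_uniformity_dist.1 hu
  obtain ⟨ψ, hψ, hd⟩ := Metric.mem_closure_iff.1 (hρ χ) ε hε
  refine ⟨_, hψ.1, fun g => hu ?_⟩
  rwa [dist_eq_norm, ← map_sub, rep_norm, ← dist_eq_norm]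

theorem IsSmoothRep.continuous_action : Continuous fun p : G × H => (ρ p.1 : H →L[ℂ] H) p.2 := by
  refine continuous_iff_continuousAt.2 fun ⟨g, χ⟩ => ?_
  have h1 : Tendsto (fun p : G × H => (ρ p.1 : H →L[ℂ] H) (p.2 - χ)) (𝓝 (g, χ)) (𝓝 0) := by
    rw [tendsto_zero_iff_norm_tendsto_zero]
    simp only [rep_norm]
    have : Continuous fun p : G × H => ‖p.2 - χ‖ := by fun_prop
    simpa using this.tendsto (g, χ)
  have h2 := ((hρ.continuous_orbit χ).comp continuous_fst).tendsto (g, χ)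
  simpa [ContinuousAt] using h1.add h2

/-- If `χ` lies weakly in the domain of the derived representation, with `dρ(η) χ = χ'(η)` for a
continuous map `χ'`, then the orbit map of `χ` is differentiable. -/
theorem IsSmoothRep.hasDirDerivAt_of_weak {χ : H} {χ' : E → H} (hχ' : Continuous χ')
    (h : ∀ (φ : smoothVectors E ρ) (η : E),
      inner ℂ (derivedRep hG ρ η φ : H) χ = - inner ℂ (φ : H) (χ' η))
    {e : OpenPartialHomeomorph G E} (he : e ∈ atlas E G) {x : E} (hx : x ∈ e.target) (v : E) :
    HasDirDerivAt (fun y => (ρ (e.symm y) : H →L[ℂ] H) χ)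
      ((ρ (e.symm x) : H →L[ℂ] H) (χ' (leftLogDeriv e (x, v)))) x v := by
  have hline : Continuous fun t : ℝ => x + t • v := by fun_prop
  let D : ℝ → H := fun t =>
    (ρ (e.symm (x + t • v)) : H →L[ℂ] H) (χ' (leftLogDeriv e (x + t • v, v)))
  -- the weak derivative along the line
  have weak : ∀ t, x + t • v ∈ e.target → ∀ φ : smoothVectors E ρ,
      HasDerivAt (fun s => inner ℂ (φ : H) ((ρ (e.symm (x + s • v)) : H →L[ℂ] H) χ))
        (inner ℂ (φ : H) (D t)) t := by
    intro t ht φ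
    set g := e.symm (x + t • v) with hg
    set η := leftLogDeriv e (x + t • v, v) with hη
    have hγ := hG.hasVelocityAtOne_leftDiv he ht v
    set γ : ℝ → G := fun s => g⁻¹ * e.symm (x + t • v + s • v) with hγd
    let φ' : smoothVectors E ρ := ⟨(ρ g⁻¹ : H →L[ℂ] H) φ, rep_mem_smoothVectors hG φ.2 g⁻¹⟩
    rw [hasDerivAt_iff_tendsto_slope_zero]
    -- The group element is moved onto the test vector, which stays smooth, so the weak relation
    -- applies at an arbitrary point of the line.
    have hval : inner ℂ (φ : H) (D t) = - inner ℂ (derivedRep hG ρ η φ' : H) χ := by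
      rw [h φ' η, neg_neg]
      exact (rep_inv_inner ρ g _ _).symm
    rw [hval]
    have h1 := tendsto_rep_curve φ'.2 hγ
    -- pass from the curve to the inverse curve
    have h2 : Tendsto (fun s : ℝ => (ρ (γ s)⁻¹ : H →L[ℂ] H)
        (s⁻¹ • ((ρ (γ s) : H →L[ℂ] H) (φ' : H) - φ'))) (𝓝[≠] 0)
        (𝓝 (derivedRep hG ρ η φ' : H)) := by
      have h3 : Tendsto (fun s => (γ s)⁻¹) (𝓝[≠] 0) (𝓝 1) := by
        have := (hG.smooth_inv.1.tendsto _).comp hγ.1.tendsto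
        rw [hγ.2.1, inv_one] at this
        exact this.mono_left nhdsWithin_le_nhds
      have h4 := (hρ.continuous_action.tendsto (1, (derivedRep hG ρ η φ' : H))).comp
        (h3.prodMk_nhds h1)
      simpa only [rep_one, Function.comp_def] using h4
    have h5 := (h2.inner (𝕜 := ℂ) (tendsto_const_nhds (x := χ))).neg
    refine h5.congr fun s => ?_
    have e1 : e.symm (x + (t + s) • v) = g * γ s := by
      simp [hγd, add_smul, add_assoc]
    have e2 : inner ℂ (φ : H) ((ρ (e.symm (x + (t + s) • v)) : H →L[ℂ] H) χ) =
        inner ℂ ((ρ (γ s)⁻¹ : H →L[ℂ] H) (φ' : H)) χ := by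
      rw [e1, rep_mul, ← rep_inv_inner, ← rep_inv_inner]
    have e3 : inner ℂ (φ : H) ((ρ (e.symm (x + t • v)) : H →L[ℂ] H) χ) =
        inner ℂ (φ' : H) χ := by
      rw [← hg, ← rep_inv_inner]
    rw [e2, e3, ContinuousLinearMap.map_smul_of_tower, map_sub, ← rep_mul, inv_mul_cancel, rep_one,
      ← Complex.coe_smul, inner_smul_left, Complex.conj_ofReal, inner_sub_left, Complex.real_smul]
    ring
  have hD : ContinuousAt D 0 := by
    have h1 : ContinuousAt (fun t : ℝ => e.symm (x + t • v)) 0 := by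
      refine ContinuousAt.comp (f := fun t : ℝ => x + t • v) ?_ hline.continuousAt
      simpa using e.continuousAt_symm hx
    have h2 : ContinuousAt (fun t : ℝ => leftLogDeriv e (x + t • v, v)) 0 := by
      refine ContinuousAt.comp (f := fun t : ℝ => (x + t • v, v)) (g := leftLogDeriv e) ?_
        (Continuous.continuousAt (by fun_prop))
      refine (hG.ckOn_leftLogDeriv he 0).continuousOn.continuousAt
        ((e.open_target.prod isOpen_univ).mem_nhds ⟨?_, trivial⟩)
      simpa using hx
    exact hρ.continuous_action.continuousAt.comp (h1.prodMk (hχ'.continuousAt.comp h2))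
  have hD0 : D 0 = (ρ (e.symm x) : H →L[ℂ] H) (χ' (leftLogDeriv e (x, v))) := by simp [D]
  rw [← hD0]
  refine Metric.tendsto_nhds.2 fun ε hε => ?_
  have hnear : ∀ᶠ t : ℝ in 𝓝 0, x + t • v ∈ e.target ∧ ‖D t - D 0‖ < ε / 2 := by
    refine (hline.continuousAt.eventually (e.open_target.mem_nhds (by simpa using hx))).and ?_
    simpa [dist_eq_norm] using Metric.tendsto_nhds.1 hD (ε / 2) (half_pos hε)
  obtain ⟨δ, hδ, hball⟩ := Metric.eventually_nhds_iff_ball.1 hnear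
  filter_upwards [mem_nhdsWithin_of_mem_nhds (Metric.ball_mem_nhds (0 : ℝ) hδ),
    self_mem_nhdsWithin] with t ht ht0
  have ht0' : 0 < |t| := abs_pos.2 ht0
  -- The mean value inequality for each pairing gives a bound proportional to `‖φ‖` with one
  -- constant for all `φ`; density turns it into a norm bound. The choice `ε / 2` makes the final
  -- inequality strict.
  have hmain : ‖(ρ (e.symm (x + t • v)) : H →L[ℂ] H) χ - (ρ (e.symm x) : H →L[ℂ] H) χ - t • D 0‖ ≤
      ε / 2 * |t| := by
    refine norm_le_of_dense_inner hρ (by positivity) fun φ hφ => ?_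
    have hder : ∀ s ∈ Metric.ball (0 : ℝ) δ, HasDerivWithinAt
        (fun s => inner ℂ φ ((ρ (e.symm (x + s • v)) : H →L[ℂ] H) χ) - s • inner ℂ φ (D 0))
        (inner ℂ φ (D s) - inner ℂ φ (D 0)) (Metric.ball 0 δ) s := by
      intro s hs
      have h1 := (weak s (hball s hs).1 ⟨φ, hφ⟩).sub
        ((hasDerivAt_id s).smul_const (inner ℂ φ (D 0)))
      exact (h1.congr_deriv (by simp)).hasDerivWithinAt
    have hbd : ∀ s ∈ Metric.ball (0 : ℝ) δ,
        ‖inner ℂ φ (D s) - inner ℂ φ (D 0)‖ ≤ ‖φ‖ * (ε / 2) := by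
      intro s hs
      rw [← inner_sub_right]
      exact (norm_inner_le_norm _ _).trans
        (mul_le_mul_of_nonneg_left (hball s hs).2.le (norm_nonneg _))
    have h1 := (convex_ball (0 : ℝ) δ).norm_image_sub_le_of_norm_hasDerivWithin_le hder hbd
      (Metric.mem_ball_self hδ) ht
    rw [inner_sub_right, inner_sub_right, ← Complex.coe_smul, inner_smul_right, ← mul_assoc]
    simp only [zero_smul, add_zero, sub_zero, Real.norm_eq_abs, Complex.real_smul] at h1
    rwa [sub_right_comm]
  rw [dist_eq_norm]
  have e1 : t⁻¹ • ((ρ (e.symm (x + t • v)) : H →L[ℂ] H) χ - (ρ (e.symm x) : H →L[ℂ] H) χ) - D 0 =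
      t⁻¹ • ((ρ (e.symm (x + t • v)) : H →L[ℂ] H) χ - (ρ (e.symm x) : H →L[ℂ] H) χ - t • D 0) := by
    rw [smul_sub _ _ (t • D 0), inv_smul_smul₀ ht0]
  rw [e1, norm_smul, norm_inv, Real.norm_eq_abs, inv_mul_lt_iff₀ ht0']
  nlinarith

end DerivedRep

/-! ### Completeness in terms of the generating seminorms -/

section Seminorms

variable {V ι : Type*} [NormedAddCommGroup V] [NormedSpace ℂ V]

theorem completeSpace_seminormUniformSpace (p : ι → Seminorm ℂ V)
    (h : ∀ 𝓕 : Filter V, 𝓕.NeBot →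
      (∀ i, ∀ ε > 0, ∃ t ∈ 𝓕, ∀ x ∈ t, ∀ y ∈ t, p i (x - y) < ε) →
      ∃ ψ, ∀ i, ∀ ε > 0, ∀ᶠ x in 𝓕, p i (x - ψ) < ε) :
    @CompleteSpace V (seminormUniformSpace p) := by
  have hdist : ∀ i (x y : V),
      @dist V (p i).toAddGroupSeminorm.toSeminormedAddCommGroup.toDist x y = p i (x - y) := by
    intro i x y
    rw [@dist_eq_norm V (p i).toAddGroupSeminorm.toSeminormedAddCommGroup]
    rfl
  refine @CompleteSpace.mk V (seminormUniformSpace p) fun {𝓕} hc => ?_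
  have hne : 𝓕.NeBot := hc.1
  obtain ⟨ψ, hψ⟩ := h 𝓕 hne fun i ε hε => by
    have hi : @Cauchy V (p i).toAddGroupSeminorm.toSeminormedAddCommGroup.toUniformSpace 𝓕 :=
      Cauchy.mono_uniformSpace (iInf_le _ i) hc
    obtain ⟨t, ht, htd⟩ := ((@Metric.cauchy_iff V
      (p i).toAddGroupSeminorm.toSeminormedAddCommGroup.toPseudoMetricSpace 𝓕).1 hi).2 ε hε
    exact ⟨t, ht, fun x hx y hy => hdist i x y ▸ htd x hx y hy⟩
  refine ⟨ψ, ?_⟩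
  rw [UniformSpace.toTopologicalSpace_iInf, nhds_iInf]
  refine le_iInf fun i => ?_
  refine (@Metric.tendsto_nhds V V
    (p i).toAddGroupSeminorm.toSeminormedAddCommGroup.toPseudoMetricSpace 𝓕 id ψ).2 fun ε hε => ?_
  filter_upwards [hψ i ε hε] with x hx
  rw [id, hdist]
  exact hx

end Seminorms

/-! ### Weak jets yield smooth vectors -/

section Jets

variable {E : Type u} [AddCommGroup E] [Module ℝ E] [TopologicalSpace E]
  [IsTopologicalAddGroup E] [ContinuousSMul ℝ E] [LocallyConvexSpace ℝ E] [T2Space E]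
  {G : Type v} [Group G] [TopologicalSpace G] [ChartedSpace E G]
  {H : Type w} [NormedAddCommGroup H] [InnerProductSpace ℂ H] [CompleteSpace H]
  (hG : IsLieGroup E G) {ρ : G →* unitary (H →L[ℂ] H)} (hρ : IsSmoothRep E ρ)

/-- The map prepending an entry to a tuple. -/
def joinFirst (E : Type u) [AddCommGroup E] [Module ℝ E] [TopologicalSpace E] (n : ℕ) :
    E × (E × (Fin n → E)) →L[ℝ] E × (Fin (n + 1) → E) where
  toFun p := (p.1, Fin.cons p.2.1 p.2.2)
  map_add' p q := by
    refine Prod.ext rfl (funext fun i => ?_)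
    refine Fin.cases ?_ (fun i => ?_) i <;> simp
  map_smul' c p := by
    refine Prod.ext rfl (funext fun i => ?_)
    refine Fin.cases ?_ (fun i => ?_) i <;> simp
  cont := by fun_prop

include hρ in
/-- A vector with a weak jet, that is, a sequence of continuous multilinear maps which weakly are
the iterated values of the derived representation, has a smooth orbit map. -/
theorem ckOn_of_weakJet {Ψ : ∀ n, MultilinearMap ℝ (fun _ : Fin n => E) H}
    (hΨ : ∀ n, Continuous (Ψ n))
    (hrel : ∀ n (φ : smoothVectors E ρ) (η : E) (ξ : Fin n → E),
      inner ℂ (derivedRep hG ρ η φ : H) (Ψ n ξ) = - inner ℂ (φ : H) (Ψ (n + 1) (Fin.cons η ξ)))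
    {e : OpenPartialHomeomorph G E} (he : e ∈ atlas E G) (k : ℕ) : ∀ n,
    CkOn k (fun p : E × (Fin n → E) => (ρ (e.symm p.1) : H →L[ℂ] H) (Ψ n p.2))
      (e.target ×ˢ univ) := by
  induction k with
  | zero =>
    intro n
    exact hρ.continuous_action.comp_continuousOn
      ((e.continuousOn_symm.comp continuousOn_fst fun p hp => hp.1).prodMk
        ((hΨ n).comp continuous_snd).continuousOn)
  | succ k ih =>
    intro n
    have hU := e.open_target.prod (isOpen_univ (X := Fin n → E))
    have hU' := hU.prod (isOpen_univ (X := E × (Fin n → E)))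
    -- The derivative at level `n` is level `n + 1` with the left logarithmic derivative prepended,
    -- so the induction on the order has to cover all levels.
    refine CkOn.succ_of_multilinear (M := fun x h => (ρ (e.symm x) : H →L[ℂ] H) (Ψ n h))
      (M' := fun x v h => (ρ (e.symm x) : H →L[ℂ] H)
        (Ψ (n + 1) (Fin.cons (leftLogDeriv e (x, v)) h))) e.open_target ?_ ?_ (ih n) ?_
    · intro y _
      exact ⟨(((ρ (e.symm y) : H →L[ℂ] H).toLinearMap).restrictScalars ℝ).compMultilinearMap (Ψ n),
        rfl⟩
    · intro x hx v h
      refine hρ.hasDirDerivAt_of_weak hG (χ := Ψ n h) (χ' := fun η => Ψ (n + 1) (Fin.cons η h))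
        ?_ (fun φ η => hrel n φ η h) he hx v
      exact (hΨ (n + 1)).comp (by fun_prop)
    · let L : (E × (Fin n → E)) × (E × (Fin n → E)) →L[ℝ] E × E :=
        (ContinuousLinearMap.fst ℝ E (Fin n → E)).prodMap (ContinuousLinearMap.fst ℝ E (Fin n → E))
      have h1 : CkOn k (fun p => leftLogDeriv e (L p)) ((e.target ×ˢ univ) ×ˢ univ) :=
        ((hG.ckOn_leftLogDeriv he k).comp_clm (e.open_target.prod isOpen_univ) L).mono
          fun p hp => ⟨hp.1.1, trivial⟩
      let P : (E × (Fin n → E)) × (E × (Fin n → E)) →L[ℝ] E × (Fin n → E) :=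
        ContinuousLinearMap.fst ℝ _ _
      have h2 := (ckOn_clm k (joinFirst E n) univ isOpen_univ).comp hU' isOpen_univ
        ((ckOn_clm k ((ContinuousLinearMap.fst ℝ _ _).comp P) _ hU').prodMk hU'
          (h1.prodMk hU' (ckOn_clm k ((ContinuousLinearMap.snd ℝ _ _).comp P) _ hU')))
        (mapsTo_univ _ _)
      exact (ih (n + 1)).comp hU' (e.open_target.prod isOpen_univ) h2
        fun p hp => ⟨hp.1.1, trivial⟩

end Jets

/-! ### Completeness for the weak and the strong topology -/

section Completeness

variable {E : Type u} [AddCommGroup E] [Module ℝ E] [UniformSpace E] [IsUniformAddGroup E]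
  [ContinuousSMul ℝ E] [LocallyConvexSpace ℝ E] [T2Space E] [CompleteSpace E]
  [IsCountablyGenerated (𝓤 E)]
  {G : Type v} [Group G] [TopologicalSpace G] [ChartedSpace E G]
  {H : Type w} [NormedAddCommGroup H] [InnerProductSpace ℂ H] [CompleteSpace H]
  (hG : IsLieGroup E G) {ρ : G →* unitary (H →L[ℂ] H)} (hρ : IsSmoothRep E ρ)

include hρ

/-- The limits of the iterated derivatives form a weak jet of continuous maps, so their value at
level zero is smooth; both topologies use this vector as the limit. -/
theorem exists_weak_limit {𝓕 : Filter (smoothVectors E ρ)} (hne : 𝓕.NeBot)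
    (h : ∀ n (ξ : Fin n → E), ∀ ε > 0, ∃ t ∈ 𝓕, ∀ x ∈ t, ∀ y ∈ t,
      weakSeminorm (derivedRep hG ρ) ξ (x - y) < ε) :
    ∃ ψ : smoothVectors E ρ, ∀ n (ξ : Fin n → E),
      Tendsto (fun φ => iter (derivedRep hG ρ) ξ φ) 𝓕 (𝓝 (iter (derivedRep hG ρ) ξ ψ)) := by
  set π := derivedRep hG ρ with hπ
  have hlim : ∀ n (ξ : Fin n → E), ∃ a : H, Tendsto (fun φ => (iter π ξ φ : H)) 𝓕 (𝓝 a) := by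
    intro n ξ
    refine cauchy_map_iff_exists_tendsto.1 (Metric.cauchy_iff.2 ⟨inferInstance, fun ε hε => ?_⟩)
    obtain ⟨t, ht, htd⟩ := h n ξ ε hε
    refine ⟨_, image_mem_map ht, ?_⟩
    rintro _ ⟨x, hx, rfl⟩ _ ⟨y, hy, rfl⟩
    have h1 := htd x hx y hy
    rw [dist_eq_norm]
    simpa [weakSeminorm] using h1
  choose L hL using hlim
  let Ψ : ∀ n, MultilinearMap ℝ (fun _ : Fin n => E) H := fun n =>
    MultilinearMap.mk' (L n)
      (fun ξ i x y => tendsto_nhds_unique (hL n _) (by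
        refine ((hL n _).add (hL n _)).congr fun φ => ?_
        simp only [hπ, ← iterMultilinear_apply, MultilinearMap.map_update_add]))
      (fun ξ i c x => tendsto_nhds_unique (hL n _) (by
        refine ((hL n _).const_smul c).congr fun φ => ?_
        simp only [hπ, ← iterMultilinear_apply, MultilinearMap.map_update_smul]))
  have hΨL : ∀ n (ξ : Fin n → E), Tendsto (fun φ => (iter π ξ φ : H)) 𝓕 (𝓝 (Ψ n ξ)) := hL
  have hrel : ∀ n (φ : smoothVectors E ρ) (η : E) (ξ : Fin n → E),
      inner ℂ (π η φ : H) (Ψ n ξ) = - inner ℂ (φ : H) (Ψ (n + 1) (Fin.cons η ξ)) := by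
    intro n φ η ξ
    refine tendsto_nhds_unique (tendsto_const_nhds.inner (hΨL n ξ))
      ((tendsto_const_nhds.inner (hΨL (n + 1) (Fin.cons η ξ))).neg.congr fun χ => ?_)
    rw [iter_succ, Fin.cons_zero, Fin.tail_cons, inner_derivedRep_left]
  -- Entries of `Ψ n` are transferred to the smooth vector until only the fixed vector `Ψ 0 0`
  -- remains; this lengthens the other tuple, hence the general `m`.
  have hcont : ∀ n m (φ : smoothVectors E ρ), Continuous fun p : (Fin m → E) × (Fin n → E) =>
      inner ℂ (iter π p.1 φ : H) (Ψ n p.2) := by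
    intro n
    induction n with
    | zero =>
      intro m φ
      have h1 := continuous_iterMultilinear hG ρ m φ
      simp only [hπ, ← iterMultilinear_apply]
      have h2 : ∀ p : (Fin m → E) × (Fin 0 → E), Ψ 0 p.2 = Ψ 0 0 := fun p => by
        rw [Subsingleton.elim p.2 0]
      simp only [h2]
      exact (h1.comp continuous_fst).inner continuous_const
    | succ n ih =>
      intro m φ
      have h1 : Continuous fun p : (Fin m → E) × (Fin (n + 1) → E) =>
          ((Fin.cons (p.2 0) p.1 : Fin (m + 1) → E), Fin.tail p.2) := by
        refine .prodMk (by fun_prop) (continuous_pi fun i => ?_)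
        exact (continuous_apply i.succ).comp continuous_snd
      refine ((ih (m + 1) φ).comp h1).neg.congr fun p => ?_
      simp only [Pi.neg_apply, Function.comp]
      rw [iter_succ, Fin.cons_zero, Fin.tail_cons, hrel, neg_neg, Fin.cons_self_tail]
  have hΨ : ∀ n, Continuous (Ψ n) := by
    intro n
    refine multilinear_continuous_of_weak (Ψ n) hρ fun φ hφ => ?_
    have h1 := (hcont n 0 ⟨φ, hφ⟩).comp (f := fun ξ => (0, ξ)) (by fun_prop)
    simpa only [Function.comp_def, iter_zero] using h1
  have hmem : Ψ 0 0 ∈ smoothVectors E ρ := by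
    rw [mem_smoothVectors_iff]
    intro e he n
    have h1 := (ckOn_of_weakJet hG hρ hΨ hrel he n 0).comp_clm
      (e.open_target.prod isOpen_univ) (ContinuousLinearMap.inl ℝ E (Fin 0 → E))
    exact h1.mono fun x hx => ⟨hx, trivial⟩
  have hiter : ∀ n (ξ : Fin n → E), (iter π ξ ⟨Ψ 0 0, hmem⟩ : H) = Ψ n ξ := by
    intro n
    induction n with
    | zero =>
      intro ξ
      rw [iter_zero, Subsingleton.elim ξ 0]
    | succ n ih =>
      intro ξ
      -- Skew-symmetry and the weak relation give both sides the same pairing with every smooth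
      -- vector.
      refine Dense.eq_of_inner_right ℂ hρ fun φ hφ => ?_
      have h1 := inner_derivedRep_left hG ρ (ξ 0) ⟨φ, hφ⟩ (iter π (Fin.tail ξ) ⟨Ψ 0 0, hmem⟩)
      rw [ih, hrel, Fin.cons_self_tail] at h1
      rw [iter_succ]
      exact (neg_injective h1).symm
  refine ⟨⟨Ψ 0 0, hmem⟩, fun n ξ => tendsto_subtype_rng.2 ?_⟩
  rw [hiter]
  exact hΨL n ξ

theorem completeSpace_weakUniformSpace :
    @CompleteSpace (smoothVectors E ρ) (weakUniformSpace (derivedRep hG ρ)) := by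
  refine completeSpace_seminormUniformSpace _ fun 𝓕 hne h => ?_
  obtain ⟨ψ, hψ⟩ := exists_weak_limit hG hρ hne fun n ξ => h ⟨n, ξ⟩
  refine ⟨ψ, fun i ε hε => ?_⟩
  filter_upwards [Metric.tendsto_nhds.1 (hψ i.1 i.2) ε hε] with φ hφ
  simpa [weakSeminorm, dist_eq_norm] using hφ

omit hρ in
-- The supremum of seminorms is pointwise for a pointwise bounded family, and boundedness of `B`
-- supplies the bounds.
theorem strongSeminorm_derivedRep_apply {n : ℕ} {B : Set (Fin n → E)}
    (hB : Bornology.IsVonNBounded ℝ B) (ψ : smoothVectors E ρ) :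
    strongSeminorm (derivedRep hG ρ) B ψ =
      ⨆ ξ : B, weakSeminorm (derivedRep hG ρ) ξ.1 ψ := by
  refine Seminorm.iSup_apply ?_
  rw [Seminorm.bddAbove_range_iff]
  intro φ
  have := strongSeminormsFinite_derivedRep hG ρ n B hB φ
  rwa [image_eq_range] at this

theorem completeSpace_strongUniformSpace :
    @CompleteSpace (smoothVectors E ρ) (strongUniformSpace (derivedRep hG ρ)) := by
  have hle : ∀ {n : ℕ} {B : Set (Fin n → E)} (hB : Bornology.IsVonNBounded ℝ B)
      {ξ : Fin n → E} (hξ : ξ ∈ B) (χ : smoothVectors E ρ),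
      weakSeminorm (derivedRep hG ρ) ξ χ ≤ strongSeminorm (derivedRep hG ρ) B χ := by
    intro n B hB ξ hξ χ
    rw [strongSeminorm_derivedRep_apply hG hB]
    have := strongSeminormsFinite_derivedRep hG ρ n B hB χ
    rw [image_eq_range] at this
    exact le_ciSup (f := fun ξ : B => weakSeminorm (derivedRep hG ρ) ξ.1 χ) this ⟨ξ, hξ⟩
  refine completeSpace_seminormUniformSpace _ fun 𝓕 hne h => ?_
  obtain ⟨ψ, hψ⟩ := exists_weak_limit hG hρ hne fun n ξ ε hε => by
    obtain ⟨t, ht, htd⟩ := h ⟨n, {ξ}, Bornology.isVonNBounded_singleton ξ⟩ ε hε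
    exact ⟨t, ht, fun x hx y hy => (hle (Bornology.isVonNBounded_singleton ξ)
      (mem_singleton ξ) _).trans_lt (htd x hx y hy)⟩
  refine ⟨ψ, ?_⟩
  rintro ⟨n, B, hB⟩ ε hε
  obtain ⟨t, ht, htd⟩ := h ⟨n, B, hB⟩ (ε / 2) (half_pos hε)
  filter_upwards [ht] with φ hφ
  refine lt_of_le_of_lt ?_ (half_lt_self hε)
  rw [strongSeminorm_derivedRep_apply hG hB]
  refine Real.iSup_le (fun ξ => ?_) (half_pos hε).le
  -- With `φ` fixed, the Cauchy estimate for `φ - χ` passes to the limit in `χ` for each `ξ`; its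
  -- bound `ε / 2` does not depend on `ξ`.
  have h1 : Tendsto (fun χ => weakSeminorm (derivedRep hG ρ) ξ.1 (φ - χ)) 𝓕
      (𝓝 (weakSeminorm (derivedRep hG ρ) ξ.1 (φ - ψ))) := by
    simp only [weakSeminorm, Seminorm.comp_apply, coe_normSeminorm, map_sub]
    exact (tendsto_const_nhds.sub (hψ n ξ.1)).norm
  refine le_of_tendsto h1 ?_
  filter_upwards [ht] with χ hχ
  exact (hle hB ξ.2 _).trans (htd φ hφ χ hχ).le

end Completeness

end LCLie

/-- Let `G` be a regular Lie group modelled on a Fréchet space `E` (its Lie algebra), and `ρ` a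
smooth unitary representation of `G` on a complex Hilbert space `H`. Then the derived
representation `dρ` on the space of smooth vectors exists, and the space of smooth vectors is
complete for the weak and for the strong topology derived from `dρ`. -/
theorem proposition3p9
    {E : Type*} [AddCommGroup E] [Module ℝ E] [UniformSpace E] [IsUniformAddGroup E]
    [ContinuousSMul ℝ E] [LocallyConvexSpace ℝ E] [T2Space E] [CompleteSpace E]
    [IsCountablyGenerated (𝓤 E)]
    {G : Type*} [Group G] [TopologicalSpace G] [ChartedSpace E G]
    (hG : LCLie.IsLieGroup E G) (hreg : LCLie.IsRegular E G)
    {H : Type*} [NormedAddCommGroup H] [InnerProductSpace ℂ H] [CompleteSpace H]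
    (ρ : G →* unitary (H →L[ℂ] H)) (hρ : LCLie.IsSmoothRep E ρ) :
    ∃ dρ : E → Module.End ℂ (LCLie.smoothVectors E ρ),
      LCLie.IsDerivedRep E ρ dρ ∧
      LCLie.StrongSeminormsFinite dρ ∧
      @CompleteSpace (LCLie.smoothVectors E ρ) (LCLie.weakUniformSpace dρ) ∧
      @CompleteSpace (LCLie.smoothVectors E ρ) (LCLie.strongUniformSpace dρ) := by
  exact ⟨LCLie.derivedRep hG ρ, LCLie.isDerivedRep_derivedRep hG ρ,
    LCLie.strongSeminormsFinite_derivedRep hG ρ, LCLie.completeSpace_weakUniformSpace hG hρ,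
    LCLie.completeSpace_strongUniformSpace hG hρ⟩
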